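/- Let $d\ge 1$ and $\lambda>0$. Regard $\mathbb{Z}^d$ as the graph in which $u,v$ are adjacent iff $\sum_j|u_j-v_j|=1$. For a finite set $\Lambda\subset\mathbb{Z}^d$ let $Z_\Lambda=\sum_I\lambda^{|I|}$, the sum being over the independent sets $I\subset\Lambda$ of this graph. A Gibbs measure of the hard-core model with activity $\lambda$ on a countable, locally finite graph $\mathbb{G}=(V,E)$ is the law of a random set $\mathbf{I}\subset V$ such that, for every finite $\Lambda\subset V$, given $\mathbf{I}\setminus\Lambda$, the set $\mathbf{I}\cap\Lambda$ equals $I$ with probability proportional to $\lambda^{|I|}$ for every independent set $I\subset\Lambda$ that has no vertex adjacent to $\mathbf{I}\setminus\Lambda$ (and with probability $0$ for all other $I$). When there is exactly one such law, it is denoted by $\mathbb{P}_{\mathbb{G}}$; a set $S\subset\mathbb{Z}^d$ also stands for the subgraph it induces. For a set $A$ of vertices let $B_r(A)$ be the set of vertices at graph distance at most $r$ from $A$, and $\partial A$ the set of vertices of $A$ with a neighbour outside $A$; write $\sigma_v=1$ if $v\in\mathbf{I}$ and $\sigma_v=0$ otherwise. The model on $\mathbb{Z}^d$ satisfies strong spatial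 mixing (SSM) if for every finite $X\subset\mathbb{Z}^d$ and every (possibly infinite) $Y\subset\mathbb{Z}^d$ there is a function $R$ with $R(r)\to0$ as $r\to\infty$ such that for all integers $r\ge1$ $$\Big|\mathbb{P}\big(\sigma_X=s^1\,\big|\,\sigma_Y=s^2,\ \sigma_{\partial B_r(X)}=s^3\big)-\mathbb{P}\big(\sigma_X=s^1\,\big|\,\sigma_Y=s^2,\ \sigma_{\partial B_r(X)}=s^4\big)\Big|\le R(r)$$ for all spin assignments $s^1,s^2,s^3,s^4$ for which both conditions are compatible with the hard-core constraint; the conditional probabilities are those of the finite-volume Gibbs distribution on $B_r(X)\setminus(Y\cup\partial B_r(X))$ with the prescribed spins on $Y\cup\partial B_r(X)$. Let $\prec$ be the lexicographic order on $\mathbb{Z}^d$ in which the last coordinate is the most significant, and let $$\mathbb{Z}^d_{\prec0}=\{u:u\prec0\}\cup\{0\},\qquad \mathbb{Z}^d_{\prec0,\mathrm{even}}=\mathbb{Z}^d_{\prec0}\cup\Big\{u:0\prec u,\ \sum_ju_j\text{ is odd}\Big\}.$$ If the hard-core model with activity $\lambda$ on $\mathbb{Z}^d$ satisfies SSM, then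 it has a unique Gibbs measure on each of the graphs $\mathbb{Z}^d_{\prec0}$ and $\mathbb{Z}^d_{\prec0,\mathrm{even}}$; the free energy $$\mathcal{P}(d,\lambda)=\lim_{n\to\infty}\frac{\log Z_{\Lambda_n}}{|\Lambda_n|}$$ exists, and is the same, for all sequences of finite sets $0\in\Lambda_1\subset\Lambda_2\subset\cdots\subset\mathbb{Z}^d$ that eventually contain every ball around $0$ and satisfy $|\partial\Lambda_n|/|\Lambda_n|\to0$; and $$\mathcal{P}(d,\lambda)=-\log\mathbb{P}_{\mathbb{Z}^d_{\prec0}}(0\notin\mathbf{I})=-\frac12\log\mathbb{P}_{\mathbb{Z}^d_{\prec0,\mathrm{even}}}(0\notin\mathbf{I})+\frac12\log(1+\lambda).$$ -/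

import Mathlib

open Filter Topology MeasureTheory

noncomputable section

namespace HardCore

variable {V : Type*}

/-- The configuration of spins in `{0, 1}` (here `false`, `true`) has no two adjacent vertices of
spin `1`: the random set `I = {v | σ v = true}` is an independent set. -/
def IsIndependent (G : SimpleGraph V) (σ : V → Bool) : Prop :=
  ∀ u v, G.Adj u v → ¬ (σ u = true ∧ σ v = true)

open Classical in
/-- Partition function `Z_Λ` of the subgraph induced by the finite set `Λ`: the sum of `lam ^ |I|`
over the independent sets `I ⊆ Λ`. -/
def partitionFunction (G : SimpleGraph V) (lam : ℝ) (Λ : Finset V) : ℝ :=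
  ∑ I ∈ Λ.powerset.filter fun I : Finset V => G.IsIndepSet (I : Set V), lam ^ I.card

open Classical in
/-- The configuration which is the indicator of `I` on `Λ`, and is `τ` outside `Λ`. -/
def glue (Λ : Finset V) (τ : V → Bool) (I : Finset V) : V → Bool :=
  fun v => if v ∈ Λ then decide (v ∈ I) else τ v

/-- `I ⊆ Λ` is admissible given the spins `τ` outside `Λ`: it is independent, and no vertex of `I`
is adjacent to a vertex outside `Λ` of spin `1`. -/
def Admissible (G : SimpleGraph V) (Λ : Finset V) (τ : V → Bool) (I : Finset V) : Prop :=
  G.IsIndepSet (I : Set V) ∧ ∀ v ∈ I, ∀ u, u ∉ Λ → G.Adj v u → τ u = false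

open Classical in
/-- The hard-core Gibbs distribution in the finite volume `Λ`, with spins frozen to `τ` outside
`Λ`, evaluated at an event `A`. -/
def condProb (G : SimpleGraph V) (lam : ℝ) (Λ : Finset V) (τ : V → Bool)
    (A : Set (V → Bool)) : ℝ :=
  (∑ I ∈ Λ.powerset with Admissible G Λ τ I ∧ glue Λ τ I ∈ A, lam ^ I.card) /
    (∑ I ∈ Λ.powerset with Admissible G Λ τ I, lam ^ I.card)

/-- Gibbs measures of the hard-core model on a countable locally finite graph: for every finite
`Λ`, resampling the spins in `Λ` from their Gibbs distribution given the spins outside `Λ` leaves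
the measure invariant (the Dobrushin-Lanford-Ruelle equations). -/
structure IsGibbs (G : SimpleGraph V) (lam : ℝ) (μ : Measure (V → Bool)) : Prop where
  isProbabilityMeasure : IsProbabilityMeasure μ
  dlr : ∀ (Λ : Finset V) (A : Set (V → Bool)), MeasurableSet A →
    μ A = ∫⁻ τ, ENNReal.ofReal (condProb G lam Λ τ A) ∂μ

/-- `μ` is the one and only Gibbs measure of the hard-core model on `G`. -/
def IsUniqueGibbs (G : SimpleGraph V) (lam : ℝ) (μ : Measure (V → Bool)) : Prop :=
  IsGibbs G lam μ ∧ ∀ ν : Measure (V → Bool), IsGibbs G lam ν → ν = μ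

/-- `B_r(A)`, the vertices at graph distance at most `r` from `A`. -/
def ball (G : SimpleGraph V) (A : Set V) (r : ℕ) : Set V :=
  {u | ∃ v ∈ A, G.edist v u ≤ (r : ℕ∞)}

/-- `∂A`, the vertices of `A` with a neighbour outside `A`. -/
def boundary (G : SimpleGraph V) (A : Set V) : Set V :=
  {v | v ∈ A ∧ ∃ u, G.Adj v u ∧ u ∉ A}

/-- Strong spatial mixing of the hard-core model on a locally finite graph. The configurations `τ`
and `τ'` carry the spins which are fixed on `Y` (the same for both) and on `∂B_r(X)` (arbitrary);
as always, only assignments compatible with the hard-core constraint are conditioned on. The set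
`Λ` of vertices of `B_r(X)` whose spin is not fixed is finite as `G` is locally finite, and its
vertices have all their neighbours in `Λ ∪ Y ∪ ∂B_r(X)`, so that no other value of `τ` or `τ'`
matters. -/
def StrongSpatialMixing (G : SimpleGraph V) (lam : ℝ) : Prop :=
  ∀ (X : Finset V) (Y : Set V), ∃ R : ℕ → ℝ, Tendsto R atTop (𝓝 0) ∧
    ∀ r : ℕ, 1 ≤ r → ∀ Λ : Finset V,
      (Λ : Set V) = ball G X r \ (Y ∪ boundary G (ball G X r)) →
      ∀ s τ τ' : V → Bool, IsIndependent G τ → IsIndependent G τ' → (∀ v ∈ Y, τ v = τ' v) →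
        |condProb G lam Λ τ {σ | ∀ v ∈ X, σ v = s v} -
          condProb G lam Λ τ' {σ | ∀ v ∈ X, σ v = s v}| ≤ R r

/-- The lattice `ℤ^d`: `u` and `v` are adjacent when their `ℓ¹`-distance is `1`. -/
def lattice (d : ℕ) : SimpleGraph (Fin d → ℤ) where
  Adj u v := ∑ j, |u j - v j| = 1
  symm := ⟨fun u v h => by simpa only [abs_sub_comm] using h⟩
  loopless := ⟨fun u h => by simp at h⟩

/-- The lexicographic order on `ℤ^d`, in which the last coordinate is the most significant. -/
def Prec {d : ℕ} (v u : Fin d → ℤ) : Prop :=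
  ∃ k, v k < u k ∧ ∀ j, k < j → v j = u j

/-- `ℤ^d_{≺0}`: the origin and all the vertices which precede it. -/
def past (d : ℕ) : Set (Fin d → ℤ) :=
  {u | Prec u 0} ∪ {0}

/-- `ℤ^d_{≺0,even}`: the set `ℤ^d_{≺0}`, and the odd vertices which succeed the origin. -/
def pastEven (d : ℕ) : Set (Fin d → ℤ) :=
  past d ∪ {u | Odd (∑ j, u j) ∧ Prec 0 u}

/-- The origin as a vertex of `ℤ^d_{≺0}`. -/
def pastOrigin (d : ℕ) : past d := ⟨0, Or.inr rfl⟩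

/-- The origin as a vertex of `ℤ^d_{≺0,even}`. -/
def pastEvenOrigin (d : ℕ) : pastEven d := ⟨0, Or.inl (Or.inr rfl)⟩

/-- Increasing sequences of finite sets which contain the origin, contain eventually any given ball
around the origin, and whose boundary is negligible (in the sense of van Hove). -/
structure IsVanHove {d : ℕ} (Λ : ℕ → Finset (Fin d → ℤ)) : Prop where
  zero_mem : 0 ∈ Λ 0
  monotone : Monotone Λ
  exhausts : ∀ r : ℕ, ∀ᶠ n in atTop, ball (lattice d) {0} r ⊆ (Λ n : Set (Fin d → ℤ))
  boundary_small : Tendsto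
    (fun n => ((boundary (lattice d) (Λ n : Set (Fin d → ℤ))).ncard : ℝ) / ((Λ n).card : ℝ))
    atTop (𝓝 0)

/-- `P` is the free energy (pressure) of the hard-core model on `ℤ^d`: the limit of
`log Z_{Λ_n} / |Λ_n|`, the same for all van Hove sequences. -/
def IsFreeEnergy (d : ℕ) (lam P : ℝ) : Prop :=
  ∀ Λ : ℕ → Finset (Fin d → ℤ), IsVanHove Λ →
    Tendsto (fun n => Real.log (partitionFunction (lattice d) lam (Λ n)) / ((Λ n).card : ℝ))
      atTop (𝓝 P)

end HardCore

end

open Filter Topology MeasureTheory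

noncomputable section

namespace HardCore

variable {V : Type*}

/-! ### Finite volume -/

/-! The proof is a chain rule for `log Z`. Adding the vertices of `Λ n` in lexicographic order
writes `log Z` as a sum of log-ratios (`sum_sub_eq_of_order`). The ratio at `v`, inverted, is the
probability that `v` is vacant in the hard-core model on the vertices of `Λ n` weakly preceding `v`
(`condProb_vacant`). Translated by `-v`, this is a model on a finite subset of `past d`, and that
subset contains any prescribed window as soon as `v` is deep inside `Λ n`.

Strong spatial mixing passes to induced subgraphs, because deleting a vertex amounts to freezing it
at spin `0` (`StrongSpatialMixing.spatialMixing_induce`). Hence the Gibbs measure there, which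
exists by compactness, is unique, and the vacancy probability at a deep `v` is close to the one at
the origin in infinite volume. In a van Hove sequence all but a negligible fraction of the vertices
are deep, and the other terms are bounded since every ratio lies in `[(1 + lam)⁻¹, 1]`
(`IsVanHove.tendsto_log_ratio`).

For the second formula, begin with all odd vertices of `Λ n`. They form an independent set, with
partition function `(1 + lam) ^ card`. Then add the even vertices in order: each sees its past and
all odd vertices, which is `pastEven d` up to translation. Each parity class has asymptotic density
`1 / 2`. -/

lemma isIndepSet_iff (G : SimpleGraph V) (I : Set V) :
    G.IsIndepSet I ↔ ∀ u ∈ I, ∀ v ∈ I, ¬ G.Adj u v := by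
  refine ⟨fun h u hu v hv huv => h hu hv huv.ne huv, fun h u hu v hv _ => h u hu v hv⟩

open Classical in
lemma sum_powerset_of_subset {M : Type*} [AddCommMonoid M] {Δ Λ : Finset V} (h : Δ ⊆ Λ)
    (f : Finset V → M) :
    ∑ I ∈ Λ.powerset, f I = ∑ J ∈ (Λ \ Δ).powerset, ∑ K ∈ Δ.powerset, f (J ∪ K) := by
  rw [← Finset.sum_product']
  refine Finset.sum_nbij' (fun I => (I \ Δ, I ∩ Δ)) (fun p => p.1 ∪ p.2) ?_ ?_ ?_ ?_ ?_
  · intro I hI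
    simp only [Finset.mem_product, Finset.mem_powerset] at hI ⊢
    exact ⟨Finset.sdiff_subset_sdiff hI le_rfl, Finset.inter_subset_right⟩
  · rintro ⟨J, K⟩ hp
    simp only [Finset.mem_product, Finset.mem_powerset] at hp ⊢
    exact Finset.union_subset (hp.1.trans Finset.sdiff_subset) (hp.2.trans h)
  · intro I _
    ext v
    simp only [Finset.mem_union, Finset.mem_sdiff, Finset.mem_inter]
    tauto
  · rintro ⟨J, K⟩ hp
    simp only [Finset.mem_product, Finset.mem_powerset] at hp
    have h1 : ∀ v ∈ J, v ∉ Δ := fun v hv => (Finset.mem_sdiff.1 (hp.1 hv)).2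
    have h2 : ∀ v ∈ K, v ∈ Δ := fun v hv => hp.2 hv
    ext v
    · simp only [Finset.mem_union, Finset.mem_sdiff]
      have := h1 v; have := h2 v; tauto
    · simp only [Finset.mem_union, Finset.mem_inter]
      have := h1 v; have := h2 v; tauto
  · intro I _
    congr 1
    ext v
    simp only [Finset.mem_union, Finset.mem_sdiff, Finset.mem_inter]
    tauto

open Classical in
/-- The total weight of the admissible sets whose configuration lies in `A`. -/
def condSum (G : SimpleGraph V) (lam : ℝ) (Λ : Finset V) (τ : V → Bool)
    (A : Set (V → Bool)) : ℝ :=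
  ∑ I ∈ Λ.powerset, if Admissible G Λ τ I ∧ glue Λ τ I ∈ A then lam ^ I.card else 0

/-- The normalisation is the case `Set.univ` of the numerator, so that facts about `condSum` serve
for both. -/
lemma condProb_eq_div (G : SimpleGraph V) (lam : ℝ) (Λ : Finset V) (τ : V → Bool)
    (A : Set (V → Bool)) :
    condProb G lam Λ τ A = condSum G lam Λ τ A / condSum G lam Λ τ Set.univ := by
  classical
  simp [condProb, condSum, Finset.sum_filter]

open Classical in
lemma condSum_univ (G : SimpleGraph V) (lam : ℝ) (Λ : Finset V) (τ : V → Bool) :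
    condSum G lam Λ τ Set.univ =
      ∑ I ∈ Λ.powerset, if Admissible G Λ τ I then lam ^ I.card else 0 := by
  simp [condSum]

lemma measurableSet_spin (v : V) (b : Bool) : MeasurableSet {σ : V → Bool | σ v = b} :=
  measurableSet_eq_fun (measurable_pi_apply v) measurable_const

lemma admissible_empty (G : SimpleGraph V) (Λ : Finset V) (τ : V → Bool) :
    Admissible G Λ τ ∅ := by
  simp [Admissible, isIndepSet_iff]

lemma condSum_mono (G : SimpleGraph V) {lam : ℝ} (hlam : 0 < lam) (Λ : Finset V) (τ : V → Bool)
    {A B : Set (V → Bool)} (h : A ⊆ B) : condSum G lam Λ τ A ≤ condSum G lam Λ τ B := by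
  classical
  refine Finset.sum_le_sum fun I _ => ?_
  split_ifs with h1 h2
  · exact le_rfl
  · exact absurd ⟨h1.1, h h1.2⟩ h2
  · positivity
  · exact le_rfl

lemma condSum_nonneg (G : SimpleGraph V) {lam : ℝ} (hlam : 0 < lam) (Λ : Finset V) (τ : V → Bool)
    (A : Set (V → Bool)) : 0 ≤ condSum G lam Λ τ A := by
  classical
  refine Finset.sum_nonneg fun I _ => ?_
  split_ifs <;> positivity

lemma condSum_univ_pos (G : SimpleGraph V) {lam : ℝ} (hlam : 0 < lam) (Λ : Finset V)
    (τ : V → Bool) : 0 < condSum G lam Λ τ Set.univ := by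
  classical
  refine Finset.sum_pos' (fun I _ => ?_) ⟨∅, Finset.empty_mem_powerset _, ?_⟩
  · split_ifs <;> positivity
  · simp [admissible_empty]

lemma condProb_nonneg (G : SimpleGraph V) {lam : ℝ} (hlam : 0 < lam) (Λ : Finset V) (τ : V → Bool)
    (A : Set (V → Bool)) : 0 ≤ condProb G lam Λ τ A := by
  rw [condProb_eq_div]
  exact div_nonneg (condSum_nonneg G hlam _ _ _) (condSum_univ_pos G hlam _ _).le

lemma condProb_le_one (G : SimpleGraph V) {lam : ℝ} (hlam : 0 < lam) (Λ : Finset V) (τ : V → Bool)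
    (A : Set (V → Bool)) : condProb G lam Λ τ A ≤ 1 := by
  rw [condProb_eq_div]
  exact div_le_one_of_le₀ (condSum_mono G hlam _ _ (Set.subset_univ _))
    (condSum_univ_pos G hlam _ _).le

lemma condProb_congr (G : SimpleGraph V) (lam : ℝ) (Λ : Finset V) {τ τ' : V → Bool}
    (A : Set (V → Bool)) (h : ∀ v ∈ Λ, ∀ u ∉ Λ, G.Adj v u → τ u = τ' u)
    (hA : ∀ I ⊆ Λ, glue Λ τ I ∈ A ↔ glue Λ τ' I ∈ A) :
    condProb G lam Λ τ A = condProb G lam Λ τ' A := by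
  classical
  have key : ∀ I ∈ Λ.powerset, (Admissible G Λ τ I ↔ Admissible G Λ τ' I) := by
    intro I hI
    rw [Finset.mem_powerset] at hI
    refine and_congr Iff.rfl (forall₂_congr fun v hv => forall₃_congr fun u hu huv => ?_)
    rw [h v (hI hv) u hu huv]
  have hs : ∀ B : Set (V → Bool), (∀ I ⊆ Λ, glue Λ τ I ∈ B ↔ glue Λ τ' I ∈ B) →
      condSum G lam Λ τ B = condSum G lam Λ τ' B := by
    intro B hB
    refine Finset.sum_congr rfl fun I hI => ?_
    simp only [key I hI, hB I (Finset.mem_powerset.1 hI)]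
  rw [condProb_eq_div, condProb_eq_div, hs A hA, hs _ (by simp)]

lemma glue_union (Δ Λ : Finset V) [DecidableEq V] (h : Δ ⊆ Λ) (τ : V → Bool) {J K : Finset V}
    (hJ : J ⊆ Λ \ Δ) (hK : K ⊆ Δ) : glue Λ τ (J ∪ K) = glue Δ (glue Λ τ J) K := by
  classical
  funext v
  have h1 : v ∈ J → v ∉ Δ := fun hv => (Finset.mem_sdiff.1 (hJ hv)).2
  have h2 : v ∈ K → v ∈ Δ := fun hv => hK hv
  have h3 : v ∈ Δ → v ∈ Λ := fun hv => h hv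
  by_cases hv : v ∈ Δ
  · simp only [glue, hv, h3 hv, if_true, Finset.mem_union]
    congr 1
    exact propext (by tauto)
  · by_cases hv' : v ∈ Λ
    · simp only [glue, hv, hv', if_true, if_false, Finset.mem_union]
      congr 1
      exact propext (by tauto)
    · simp [glue, hv, hv']

/-- Since `J` lies outside `Δ`, the exclusion between `J` and `K` is precisely the boundary
constraint that `glue Λ τ J` imposes on `K` in the volume `Δ`. -/
lemma admissible_union (G : SimpleGraph V) [DecidableEq V] {Δ Λ : Finset V} (h : Δ ⊆ Λ)
    (τ : V → Bool) {J K : Finset V} (hJ : J ⊆ Λ \ Δ) :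
    Admissible G Λ τ (J ∪ K) ↔ Admissible G Λ τ J ∧ Admissible G Δ (glue Λ τ J) K := by
  classical
  have h1 : ∀ v ∈ J, v ∈ Λ ∧ v ∉ Δ := fun v hv => Finset.mem_sdiff.1 (hJ hv)
  simp only [Admissible, isIndepSet_iff, Finset.mem_coe, Finset.mem_union]
  constructor
  · rintro ⟨hi, hn⟩
    refine ⟨⟨fun u hu v hv => hi u (.inl hu) v (.inl hv), fun v hv => hn v (.inl hv)⟩,
      fun u hu v hv => hi u (.inr hu) v (.inr hv), fun v hv u hu huv => ?_⟩
    by_cases hu' : u ∈ Λ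
    · simp only [glue, hu', if_true, decide_eq_false_iff_not]
      exact fun huJ => hi v (.inr hv) u (.inl huJ) huv
    · simp only [glue, hu', if_false]
      exact hn v (.inr hv) u hu' huv
  · rintro ⟨⟨hi, hn⟩, hi', hn'⟩
    have hc : ∀ v ∈ K, ∀ u ∈ J, ¬ G.Adj v u := by
      intro v hv u hu huv
      have := hn' v hv u (h1 u hu).2 huv
      simp [glue, (h1 u hu).1, hu] at this
    refine ⟨?_, ?_⟩
    · rintro u (hu | hu) v (hv | hv)
      · exact hi u hu v hv
      · exact fun huv => hc v hv u hu huv.symm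
      · exact hc u hu v hv
      · exact hi' u hu v hv
    · rintro v (hv | hv) u hu huv
      · exact hn v hv u hu huv
      · have := hn' v hv u (fun h' => hu (h h')) huv
        simpa [glue, hu] using this

lemma condProb_glue (G : SimpleGraph V) (lam : ℝ) (Δ : Finset V) (τ : V → Bool) (K : Finset V)
    (A : Set (V → Bool)) : condProb G lam Δ (glue Δ τ K) A = condProb G lam Δ τ A := by
  classical
  refine condProb_congr G lam Δ A (fun v _ u hu _ => by simp [glue, hu]) fun I _ => ?_
  have : glue Δ (glue Δ τ K) I = glue Δ τ I := by
    funext v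
    by_cases hv : v ∈ Δ <;> simp [glue, hv]
  rw [this]

open Classical in
/-- Consistency of the finite-volume Gibbs distributions. -/
lemma condSum_eq_sum_condProb (G : SimpleGraph V) {lam : ℝ} (hlam : 0 < lam) {Δ Λ : Finset V}
    (h : Δ ⊆ Λ) (τ : V → Bool) (A : Set (V → Bool)) :
    condSum G lam Λ τ A =
      ∑ I ∈ Λ.powerset, if Admissible G Λ τ I then
        lam ^ I.card * condProb G lam Δ (glue Λ τ I) A else 0 := by
  rw [condSum, sum_powerset_of_subset h, sum_powerset_of_subset h]
  refine Finset.sum_congr rfl fun J hJ => ?_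
  rw [Finset.mem_powerset] at hJ
  have hcard : ∀ K ⊆ Δ, (J ∪ K).card = J.card + K.card := fun K hK =>
    Finset.card_union_of_disjoint (Finset.disjoint_left.2 fun v hv hv' =>
      (Finset.mem_sdiff.1 (hJ hv)).2 (hK hv'))
  -- For fixed admissible `J`, both inner sums equal `lam ^ J.card` times `condSum` in `Δ` with
  -- boundary spins `glue Λ τ J`: on the right, `condProb` does not depend on `K` and cancels the
  -- normalisation. If `J` is inadmissible, both vanish.
  by_cases hJa : Admissible G Λ τ J
  · have e1 : ∀ K ∈ Δ.powerset, (if Admissible G Λ τ (J ∪ K) ∧ glue Λ τ (J ∪ K) ∈ A then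
        lam ^ (J ∪ K).card else 0) = lam ^ J.card *
        (if Admissible G Δ (glue Λ τ J) K ∧ glue Δ (glue Λ τ J) K ∈ A then lam ^ K.card else 0) := by
      intro K hK
      rw [Finset.mem_powerset] at hK
      rw [glue_union Δ Λ h τ hJ hK, hcard K hK]
      simp only [admissible_union G h τ hJ, hJa, true_and, pow_add, mul_ite, mul_zero]
    have e2 : ∀ K ∈ Δ.powerset, (if Admissible G Λ τ (J ∪ K) then
        lam ^ (J ∪ K).card * condProb G lam Δ (glue Λ τ (J ∪ K)) A else 0) =
        lam ^ J.card * condProb G lam Δ (glue Λ τ J) A *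
        (if Admissible G Δ (glue Λ τ J) K then lam ^ K.card else 0) := by
      intro K hK
      rw [Finset.mem_powerset] at hK
      rw [glue_union Δ Λ h τ hJ hK, hcard K hK, condProb_glue]
      simp only [admissible_union G h τ hJ, hJa, pow_add, mul_ite, mul_zero, true_and]
      congr 1
      ring
    rw [Finset.sum_congr rfl e1, Finset.sum_congr rfl e2, ← Finset.mul_sum, ← Finset.mul_sum,
      ← condSum_univ, ← condSum, condProb_eq_div, mul_assoc, div_mul_cancel₀ _ (condSum_univ_pos G hlam _ _).ne']
  · refine Finset.sum_congr rfl fun K hK => ?_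
    rw [Finset.mem_powerset] at hK
    simp [admissible_union G h τ hJ, hJa]

open Classical in
/-- The hard-core Gibbs distribution in the finite volume `Λ`, as a measure. -/
def gibbsMeasure (G : SimpleGraph V) (lam : ℝ) (Λ : Finset V) (τ : V → Bool) :
    Measure (V → Bool) :=
  ∑ I ∈ Λ.powerset, ENNReal.ofReal
    ((if Admissible G Λ τ I then lam ^ I.card else 0) / condSum G lam Λ τ Set.univ) •
      Measure.dirac (glue Λ τ I)

lemma gibbsMeasure_apply (G : SimpleGraph V) {lam : ℝ} (hlam : 0 < lam) (Λ : Finset V)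
    (τ : V → Bool) {A : Set (V → Bool)} (hA : MeasurableSet A) :
    gibbsMeasure G lam Λ τ A = ENNReal.ofReal (condProb G lam Λ τ A) := by
  classical
  have hZ := condSum_univ_pos G hlam Λ τ
  rw [condProb_eq_div, condSum, Finset.sum_div, ENNReal.ofReal_sum_of_nonneg, gibbsMeasure,
    Measure.finsetSum_apply]
  · refine Finset.sum_congr rfl fun I _ => ?_
    rw [Measure.smul_apply, Measure.dirac_apply' _ hA, smul_eq_mul]
    by_cases h1 : glue Λ τ I ∈ A
    · simp [h1]
    · simp [h1]
  · intro I _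
    split_ifs <;> positivity

lemma isProbabilityMeasure_gibbsMeasure (G : SimpleGraph V) {lam : ℝ} (hlam : 0 < lam)
    (Λ : Finset V) (τ : V → Bool) : IsProbabilityMeasure (gibbsMeasure G lam Λ τ) := by
  refine ⟨?_⟩
  rw [gibbsMeasure_apply G hlam Λ τ MeasurableSet.univ, condProb_eq_div,
    div_self (condSum_univ_pos G hlam _ _).ne', ENNReal.ofReal_one]

lemma measurable_glue (Λ I : Finset V) : Measurable fun τ : V → Bool => glue Λ τ I := by
  classical
  refine measurable_pi_lambda _ fun v => ?_
  by_cases hv : v ∈ Λ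
  · simp only [glue, hv, if_true]; exact measurable_const
  · simp only [glue, hv, if_false]; exact measurable_pi_apply v

lemma measurableSet_admissible [Countable V] (G : SimpleGraph V) (Λ I : Finset V) :
    MeasurableSet {τ : V → Bool | Admissible G Λ τ I} := by
  simp only [Admissible, Set.ofPred_and, Set.ofPred_forall]
  refine (MeasurableSet.const _).inter ?_
  refine Finset.measurableSet_biInter _ fun v _ => MeasurableSet.iInter fun u =>
    MeasurableSet.iInter fun _ => MeasurableSet.iInter fun _ => ?_
  exact measurableSet_spin u false

lemma measurable_condSum [Countable V] (G : SimpleGraph V) (lam : ℝ) (Λ : Finset V)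
    {A : Set (V → Bool)} (hA : MeasurableSet A) :
    Measurable fun τ => condSum G lam Λ τ A := by
  classical
  refine Finset.measurable_sum _ fun I _ => ?_
  exact Measurable.ite ((measurableSet_admissible G Λ I).inter (measurable_glue Λ I hA))
    measurable_const measurable_const

lemma measurable_condProb [Countable V] (G : SimpleGraph V) (lam : ℝ) (Λ : Finset V)
    {A : Set (V → Bool)} (hA : MeasurableSet A) :
    Measurable fun τ => condProb G lam Λ τ A := by
  simp only [condProb_eq_div]
  exact (measurable_condSum G lam Λ hA).div (measurable_condSum G lam Λ MeasurableSet.univ)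

/-- The tower property: a finite-volume distribution satisfies the DLR equations in every smaller
volume. Hence limit points are Gibbs, and mixing estimates apply to large finite volumes too. -/
lemma gibbsMeasure_dlr [Countable V] (G : SimpleGraph V) {lam : ℝ} (hlam : 0 < lam)
    {Δ Λ : Finset V} (h : Δ ⊆ Λ) (τ : V → Bool) {A : Set (V → Bool)} (hA : MeasurableSet A) :
    gibbsMeasure G lam Λ τ A =
      ∫⁻ σ, ENNReal.ofReal (condProb G lam Δ σ A) ∂(gibbsMeasure G lam Λ τ) := by
  classical
  have hZ := condSum_univ_pos G hlam Λ τ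
  have hm : Measurable fun σ => ENNReal.ofReal (condProb G lam Δ σ A) :=
    (measurable_condProb G lam Δ hA).ennreal_ofReal
  rw [gibbsMeasure_apply G hlam Λ τ hA, condProb_eq_div, condSum_eq_sum_condProb G hlam h,
    Finset.sum_div, ENNReal.ofReal_sum_of_nonneg, gibbsMeasure, lintegral_finsetSum_measure]
  · refine Finset.sum_congr rfl fun I _ => ?_
    rw [lintegral_smul_measure, lintegral_dirac' _ hm, smul_eq_mul,
      ← ENNReal.ofReal_mul (by split_ifs <;> positivity)]
    congr 1
    split_ifs
    · ring
    · simp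
  · intro I _
    have := condProb_nonneg G hlam Δ (glue Λ τ I) A
    split_ifs <;> positivity

/-- A random configuration drawn in a finite volume with empty boundary condition is
independent. -/
lemma ae_isIndependent_gibbsMeasure [Countable V] (G : SimpleGraph V) {lam : ℝ} (hlam : 0 < lam)
    (Λ : Finset V) :
    ∀ᵐ σ ∂(gibbsMeasure G lam Λ fun _ => false), IsIndependent G σ := by
  classical
  simp only [IsIndependent, ae_all_iff]
  intro u v huv
  rw [ae_iff]
  have hs : {σ : V → Bool | ¬ ¬ (σ u = true ∧ σ v = true)} =
      {σ | σ u = true} ∩ {σ | σ v = true} := by ext; simp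
  rw [hs, gibbsMeasure_apply G hlam _ _ ((measurableSet_spin u true).inter
    (measurableSet_spin v true)), condProb_eq_div]
  have : condSum G lam Λ (fun _ => false) ({σ | σ u = true} ∩ {σ | σ v = true}) = 0 := by
    refine Finset.sum_eq_zero fun I _ => if_neg ?_
    rintro ⟨⟨h1, -⟩, h2, h3⟩
    simp only [Set.mem_ofPred_eq, glue] at h2 h3
    have hu : u ∈ I := by
      by_contra hu
      simp [hu] at h2
    have hv : v ∈ I := by
      by_contra hv
      simp [hv] at h3
    exact (isIndepSet_iff G _).1 h1 u hu v hv huv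
  simp [this]

/-! ### Cylinder events -/

/-- The event that the spins on `X` are those of `s`. -/
def cylinder (X : Finset V) (s : V → Bool) : Set (V → Bool) := {σ | ∀ v ∈ X, σ v = s v}

lemma mem_cylinder {X : Finset V} {s σ : V → Bool} : σ ∈ cylinder X s ↔ ∀ v ∈ X, σ v = s v :=
  Iff.rfl

lemma cylinder_eq_biInter (X : Finset V) (s : V → Bool) :
    cylinder X s = ⋂ v ∈ X, {σ | σ v = s v} := by
  ext σ; simp [mem_cylinder]

lemma measurableSet_cylinder (X : Finset V) (s : V → Bool) : MeasurableSet (cylinder X s) := by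
  rw [cylinder_eq_biInter]
  exact Finset.measurableSet_biInter _ fun v _ => measurableSet_spin v (s v)

lemma isClopen_spin (v : V) (b : Bool) : IsClopen {σ : V → Bool | σ v = b} :=
  (isClopen_discrete {b}).preimage (continuous_apply v)

lemma isClopen_cylinder (X : Finset V) (s : V → Bool) : IsClopen (cylinder X s) := by
  rw [cylinder_eq_biInter]
  exact isClopen_biInter_finset fun v _ => isClopen_spin v (s v)

/-- Probability measures on configurations which agree on cylinders are equal. -/
lemma measure_ext_of_cylinder {μ ν : Measure (V → Bool)} [IsProbabilityMeasure μ]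
    [IsProbabilityMeasure ν] (h : ∀ X s, μ (cylinder X s) = ν (cylinder X s)) : μ = ν := by
  classical
  refine ext_of_generate_finite {A | ∃ X s, A = cylinder X s} ?_ ?_ ?_ (by simp)
  · apply le_antisymm
    · refine iSup_le fun v => ?_
      rw [← measurable_iff_comap_le]
      refine @measurable_to_bool _ (MeasurableSpace.generateFrom _) _ ?_
      refine MeasurableSpace.measurableSet_generateFrom ⟨{v}, fun _ => true, ?_⟩
      ext σ
      simp [mem_cylinder]
    · refine MeasurableSpace.generateFrom_le ?_
      rintro _ ⟨X, s, rfl⟩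
      exact measurableSet_cylinder X s
  -- Only nonempty intersections matter for a π-system; any common element `ρ` supplies the spins on
  -- `X ∪ X'`.
  · rintro _ ⟨X, s, rfl⟩ _ ⟨X', s', rfl⟩ ⟨ρ, h1, h2⟩
    refine ⟨X ∪ X', ρ, ?_⟩
    ext σ
    simp only [Set.mem_inter_iff, mem_cylinder, Finset.mem_union] at h1 h2 ⊢
    constructor
    · rintro ⟨h3, h4⟩ v (hv | hv)
      · rw [h3 v hv, h1 v hv]
      · rw [h4 v hv, h2 v hv]
    · intro h3
      exact ⟨fun v hv => by rw [h3 v (.inl hv), h1 v hv],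
        fun v hv => by rw [h3 v (.inr hv), h2 v hv]⟩
  · rintro _ ⟨X, s, rfl⟩
    exact h X s

/-! ### Existence of Gibbs measures -/

lemma continuous_glue (Λ I : Finset V) : Continuous fun τ : V → Bool => glue Λ τ I := by
  classical
  refine continuous_pi fun v => ?_
  by_cases hv : v ∈ Λ
  · simp only [glue, hv, if_true]; exact continuous_const
  · simp only [glue, hv, if_false]; exact continuous_apply v

/-- By local finiteness, admissibility reads only finitely many spins. This makes `condProb`
continuous in the boundary condition, so that the DLR equations survive weak limits. -/
lemma isClopen_admissible {G : SimpleGraph V} (hG : ∀ v, {u | G.Adj v u}.Finite)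
    (Λ I : Finset V) : IsClopen {τ : V → Bool | Admissible G Λ τ I} := by
  by_cases hI : G.IsIndepSet (I : Set V)
  · have : {τ : V → Bool | Admissible G Λ τ I} =
        ⋂ v ∈ I, ⋂ u ∈ {u | G.Adj v u} \ Λ, {τ | τ u = false} := by
      ext τ
      simp only [Admissible, hI, true_and, Set.mem_ofPred_eq, Set.mem_iInter, Set.mem_sdiff,
        Finset.mem_coe]
      exact forall₂_congr fun v _ => ⟨fun h u hu => h u hu.2 hu.1, fun h u h1 h2 => h u ⟨h2, h1⟩⟩
    rw [this]
    exact isClopen_biInter_finset fun v _ =>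
      ((hG v).subset Set.sdiff_subset).isClopen_biInter fun u _ => isClopen_spin u false
  · have : {τ : V → Bool | Admissible G Λ τ I} = ∅ := by
      ext τ; simp [Admissible, hI]
    rw [this]
    exact isClopen_empty

lemma continuous_condSum {G : SimpleGraph V} (hG : ∀ v, {u | G.Adj v u}.Finite) (lam : ℝ)
    (Λ : Finset V) {A : Set (V → Bool)} (hA : IsClopen A) :
    Continuous fun τ => condSum G lam Λ τ A := by
  classical
  refine continuous_finsetSum _ fun I _ => ?_
  have h : IsClopen {τ : V → Bool | Admissible G Λ τ I ∧ glue Λ τ I ∈ A} :=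
    (isClopen_admissible hG Λ I).inter (hA.preimage (continuous_glue Λ I))
  refine Continuous.if (fun a ha => ?_) continuous_const continuous_const
  rw [h.frontier_eq] at ha
  exact ha.elim

lemma continuous_condProb {G : SimpleGraph V} (hG : ∀ v, {u | G.Adj v u}.Finite) {lam : ℝ}
    (hlam : 0 < lam) (Λ : Finset V) {A : Set (V → Bool)} (hA : IsClopen A) :
    Continuous fun τ => condProb G lam Λ τ A := by
  simp only [condProb_eq_div]
  exact (continuous_condSum hG lam Λ hA).div (continuous_condSum hG lam Λ isClopen_univ)
    fun τ => (condSum_univ_pos G hlam Λ τ).ne'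

lemma measurable_gibbsMeasure [Countable V] (G : SimpleGraph V) {lam : ℝ} (hlam : 0 < lam)
    (Λ : Finset V) : Measurable (gibbsMeasure G lam Λ) := by
  refine Measure.measurable_of_measurable_coe _ fun A hA => ?_
  simp only [gibbsMeasure_apply G hlam Λ _ hA]
  exact (measurable_condProb G lam Λ hA).ennreal_ofReal

lemma bind_gibbsMeasure_apply [Countable V] (G : SimpleGraph V) {lam : ℝ} (hlam : 0 < lam)
    (Λ : Finset V) (μ : Measure (V → Bool)) {A : Set (V → Bool)} (hA : MeasurableSet A) :
    μ.bind (gibbsMeasure G lam Λ) A = ∫⁻ τ, ENNReal.ofReal (condProb G lam Λ τ A) ∂μ := by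
  rw [Measure.bind_apply hA (measurable_gibbsMeasure G hlam Λ).aemeasurable]
  simp only [gibbsMeasure_apply G hlam Λ _ hA]

lemma lintegral_condProb [Countable V] (G : SimpleGraph V) {lam : ℝ} (hlam : 0 < lam)
    (Λ : Finset V) (μ : Measure (V → Bool)) [IsProbabilityMeasure μ] {A : Set (V → Bool)}
    (hA : MeasurableSet A) :
    ∫⁻ τ, ENNReal.ofReal (condProb G lam Λ τ A) ∂μ =
      ENNReal.ofReal (∫ τ, condProb G lam Λ τ A ∂μ) := by
  rw [ofReal_integral_eq_lintegral_ofReal]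
  · refine Integrable.of_bound (measurable_condProb G lam Λ hA).aestronglyMeasurable 1
      (Eventually.of_forall fun τ => ?_)
    rw [Real.norm_eq_abs, abs_of_nonneg (condProb_nonneg G hlam _ _ _)]
    exact condProb_le_one G hlam _ _ _
  · exact Eventually.of_forall fun τ => condProb_nonneg G hlam _ _ _

/-- The DLR equations need to be checked on cylinders only. -/
lemma isGibbs_of_cylinder [Countable V] {G : SimpleGraph V} {lam : ℝ} (hlam : 0 < lam)
    {μ : Measure (V → Bool)} [IsProbabilityMeasure μ]
    (h : ∀ (Λ X : Finset V) (s : V → Bool),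
      μ.real (cylinder X s) = ∫ τ, condProb G lam Λ τ (cylinder X s) ∂μ) :
    IsGibbs G lam μ := by
  refine ⟨inferInstance, fun Λ A hA => ?_⟩
  have : IsProbabilityMeasure (μ.bind (gibbsMeasure G lam Λ)) := by
    refine ⟨?_⟩
    rw [Measure.bind_apply MeasurableSet.univ (measurable_gibbsMeasure G hlam Λ).aemeasurable]
    have := fun τ => isProbabilityMeasure_gibbsMeasure G hlam Λ τ
    simp
  rw [← bind_gibbsMeasure_apply G hlam Λ μ hA]
  congr 1
  refine measure_ext_of_cylinder fun X s => ?_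
  rw [bind_gibbsMeasure_apply G hlam Λ μ (measurableSet_cylinder X s),
    lintegral_condProb G hlam Λ μ (measurableSet_cylinder X s), ← h Λ X s, ofReal_measureReal]

/-- The probability measures on the compact space of configurations form a compact space, so the
finite-volume distributions converge along an ultrafilter finer than `atTop`. Both sides of a DLR
equation on a cylinder are integrals of continuous functions, and they agree as soon as `Δ ⊆ Λ`. -/
lemma exists_isGibbs [Countable V] {G : SimpleGraph V} (hG : ∀ v, {u | G.Adj v u}.Finite)
    {lam : ℝ} (hlam : 0 < lam) : ∃ μ : Measure (V → Bool), IsGibbs G lam μ := by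
  classical
  let F : Finset V → ProbabilityMeasure (V → Bool) := fun Λ =>
    ⟨gibbsMeasure G lam Λ fun _ => false, isProbabilityMeasure_gibbsMeasure G hlam Λ _⟩
  let U : Ultrafilter (Finset V) := Ultrafilter.of atTop
  let μ : ProbabilityMeasure (V → Bool) := (U.map F).lim
  have hlim : Tendsto F U (𝓝 μ) := (U.map F).le_nhds_lim
  rw [ProbabilityMeasure.tendsto_iff_forall_integral_tendsto] at hlim
  refine ⟨μ, isGibbs_of_cylinder hlam fun Δ X s => ?_⟩
  have hcl := isClopen_cylinder X s
  have hms := measurableSet_cylinder X s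
  have h1 := hlim (BoundedContinuousFunction.mkOfCompact
    ⟨_, continuous_condProb hG hlam Δ hcl⟩)
  have hc2 : Continuous fun σ => if σ ∈ cylinder X s then (1 : ℝ) else 0 :=
    Continuous.if (fun a ha => by
      change a ∈ frontier (cylinder X s) at ha
      rw [hcl.frontier_eq] at ha; exact ha.elim) continuous_const continuous_const
  have h2 := hlim (BoundedContinuousFunction.mkOfCompact ⟨_, hc2⟩)
  simp only [BoundedContinuousFunction.mkOfCompact_apply, ContinuousMap.coe_mk] at h1 h2
  have hind : ∀ ρ : ProbabilityMeasure (V → Bool),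
      ∫ σ, (if σ ∈ cylinder X s then (1 : ℝ) else 0) ∂(ρ : Measure (V → Bool)) =
        (ρ : Measure (V → Bool)).real (cylinder X s) := by
    intro ρ
    rw [← integral_indicator_one hms]
    rfl
  simp only [hind] at h2
  refine tendsto_nhds_unique h2 (h1.congr' ?_)
  have hev : ∀ᶠ Λ in (U : Filter (Finset V)), Δ ⊆ Λ :=
    (Ultrafilter.of_le (atTop : Filter (Finset V))) (eventually_ge_atTop Δ)
  filter_upwards [hev] with Λ hΛ
  have hp : IsProbabilityMeasure (gibbsMeasure G lam Λ fun _ => false) :=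
    isProbabilityMeasure_gibbsMeasure G hlam Λ _
  have h3 := gibbsMeasure_dlr G hlam hΛ (fun _ => false) hms
  rw [lintegral_condProb G hlam Δ _ hms] at h3
  change _ = (gibbsMeasure G lam Λ fun _ => false).real (cylinder X s)
  rw [measureReal_def, h3, ENNReal.toReal_ofReal]
  · rfl
  · exact integral_nonneg fun τ => condProb_nonneg G hlam _ _ _

/-! ### Uniqueness of Gibbs measures -/

lemma condProb_pair_eq_zero (G : SimpleGraph V) [DecidableEq V] (lam : ℝ) {u v : V}
    (huv : G.Adj u v) (τ : V → Bool) :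
    condProb G lam {u, v} τ ({σ | σ u = true} ∩ {σ | σ v = true}) = 0 := by
  classical
  rw [condProb_eq_div, condSum, Finset.sum_eq_zero, zero_div]
  refine fun I _ => if_neg ?_
  rintro ⟨⟨h1, -⟩, h2, h3⟩
  have hu : u ∈ I := by simpa [glue] using h2
  have hv : v ∈ I := by simpa [glue] using h3
  exact (isIndepSet_iff G _).1 h1 u hu v hv huv

/-- Mixing bounds concern independent boundary conditions only. The DLR equation in the volume `{u,
v}` excludes a doubly occupied edge, and there are countably many edges. -/
lemma IsGibbs.ae_isIndependent [Countable V] {G : SimpleGraph V} {lam : ℝ}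
    {μ : Measure (V → Bool)} (hμ : IsGibbs G lam μ) : ∀ᵐ σ ∂μ, IsIndependent G σ := by
  classical
  simp only [IsIndependent, ae_all_iff]
  intro u v huv
  rw [ae_iff]
  have hs : {σ : V → Bool | ¬ ¬ (σ u = true ∧ σ v = true)} =
      {σ | σ u = true} ∩ {σ | σ v = true} := by ext; simp
  rw [hs, hμ.dlr {u, v} _ ((measurableSet_spin u true).inter (measurableSet_spin v true))]
  simp [condProb_pair_eq_zero G lam huv]

/-- `μ A` is an average of `condProb`, so it inherits any uniform bound. Only the DLR equation for
this `Λ` and `A` is assumed, which covers Gibbs measures and finite-volume distributions alike. -/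
lemma abs_measureReal_sub_le [Countable V] (G : SimpleGraph V) {lam : ℝ} (hlam : 0 < lam)
    {Λ : Finset V} {μ : Measure (V → Bool)} [IsProbabilityMeasure μ]
    (hμ : ∀ᵐ σ ∂μ, IsIndependent G σ) {A : Set (V → Bool)} (hA : MeasurableSet A)
    (hdlr : μ A = ∫⁻ τ, ENNReal.ofReal (condProb G lam Λ τ A) ∂μ) {c ε : ℝ}
    (h : ∀ τ, IsIndependent G τ → |condProb G lam Λ τ A - c| ≤ ε) :
    |μ.real A - c| ≤ ε := by
  have hint : Integrable (fun τ => condProb G lam Λ τ A) μ := by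
    refine Integrable.of_bound (measurable_condProb G lam Λ hA).aestronglyMeasurable 1
      (Eventually.of_forall fun τ => ?_)
    rw [Real.norm_eq_abs, abs_of_nonneg (condProb_nonneg G hlam _ _ _)]
    exact condProb_le_one G hlam _ _ _
  have h1 : μ.real A = ∫ τ, condProb G lam Λ τ A ∂μ := by
    rw [measureReal_def, hdlr, lintegral_condProb G hlam Λ μ hA, ENNReal.toReal_ofReal]
    exact integral_nonneg fun τ => condProb_nonneg G hlam _ _ _
  have h2 : μ.real A - c = ∫ τ, (condProb G lam Λ τ A - c) ∂μ := by
    rw [integral_sub hint (integrable_const c), ← h1]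
    simp
  rw [h2, ← Real.norm_eq_abs]
  refine (norm_integral_le_of_norm_le_const (C := ε) ?_).trans (by simp)
  filter_upwards [hμ] with τ hτ using h τ hτ

/-- The influence of the boundary condition on any finite set of spins vanishes in large
volumes. -/
def SpatialMixing (G : SimpleGraph V) (lam : ℝ) : Prop :=
  ∀ (X : Finset V) (ε : ℝ), 0 < ε → ∃ Λ : Finset V, X ⊆ Λ ∧
    ∀ s τ : V → Bool, IsIndependent G τ →
      |condProb G lam Λ τ (cylinder X s) - condProb G lam Λ (fun _ => false) (cylinder X s)| ≤ ε

lemma SpatialMixing.isUniqueGibbs [Countable V] {G : SimpleGraph V} {lam : ℝ} (hlam : 0 < lam)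
    (h : SpatialMixing G lam) {μ : Measure (V → Bool)} (hμ : IsGibbs G lam μ) :
    IsUniqueGibbs G lam μ := by
  refine ⟨hμ, fun ν hν => ?_⟩
  have := hμ.isProbabilityMeasure
  have := hν.isProbabilityMeasure
  refine measure_ext_of_cylinder fun X s => ?_
  have hms := measurableSet_cylinder X s
  rw [← measureReal_eq_measureReal_iff]
  refine eq_of_forall_dist_le fun ε hε => ?_
  obtain ⟨Λ, -, hΛ⟩ := h X (ε / 2) (half_pos hε)
  have h1 := abs_measureReal_sub_le G hlam hμ.ae_isIndependent hms (hμ.dlr Λ _ hms) (hΛ s)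
  have h2 := abs_measureReal_sub_le G hlam hν.ae_isIndependent hms (hν.dlr Λ _ hms) (hΛ s)
  rw [Real.dist_eq]
  rw [abs_le] at h1 h2 ⊢
  constructor <;> linarith [h1.1, h1.2, h2.1, h2.2]

/-- Under spatial mixing, finite-volume probabilities with empty boundary condition converge to
those of the Gibbs measure. -/
lemma SpatialMixing.exists_condProb_near [Countable V] {G : SimpleGraph V} {lam : ℝ}
    (hlam : 0 < lam) (h : SpatialMixing G lam) {μ : Measure (V → Bool)} (hμ : IsGibbs G lam μ)
    (X : Finset V) (s : V → Bool) {ε : ℝ} (hε : 0 < ε) :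
    ∃ Λ : Finset V, X ⊆ Λ ∧ ∀ Λ' : Finset V, Λ ⊆ Λ' →
      |condProb G lam Λ' (fun _ => false) (cylinder X s) - μ.real (cylinder X s)| ≤ ε := by
  obtain ⟨Λ, hX, hΛ⟩ := h X (ε / 2) (half_pos hε)
  refine ⟨Λ, hX, fun Λ' hΛ' => ?_⟩
  have := hμ.isProbabilityMeasure
  have := isProbabilityMeasure_gibbsMeasure G hlam Λ' fun _ => false
  have hms := measurableSet_cylinder X s
  have h1 := abs_measureReal_sub_le G hlam hμ.ae_isIndependent hms (hμ.dlr Λ _ hms) (hΛ s)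
  have h2 := abs_measureReal_sub_le G hlam (ae_isIndependent_gibbsMeasure G hlam Λ') hms
    (gibbsMeasure_dlr G hlam hΛ' _ hms) (hΛ s)
  rw [measureReal_def (gibbsMeasure _ _ _ _), gibbsMeasure_apply G hlam _ _ hms,
    ENNReal.toReal_ofReal (condProb_nonneg G hlam _ _ _)] at h2
  rw [abs_le] at h1 h2 ⊢
  constructor <;> linarith [h1.1, h1.2, h2.1, h2.2]

/-! ### Induced subgraphs -/

open Classical in
lemma glue_map (S : Set V) (Λ I : Finset S) (τ : V → Bool) :
    (fun v : S => glue (Λ.map (.subtype _)) τ (I.map (.subtype _)) v) =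
      glue Λ (fun v => τ v) I := by
  funext v
  simp only [glue, Finset.mem_map, Function.Embedding.subtype_apply, Subtype.exists,
    exists_and_right, exists_eq_right, Subtype.coe_eta, Subtype.coe_prop, exists_const]
  congr

lemma admissible_map (G : SimpleGraph V) (S : Set V) (Λ I : Finset S) (τ : V → Bool)
    (hτ : ∀ v ∉ S, τ v = false) :
    Admissible G (Λ.map (.subtype _)) τ (I.map (.subtype _)) ↔
      Admissible (G.induce S) Λ (fun v => τ v) I := by
  simp only [Admissible, isIndepSet_iff, Finset.mem_coe, Finset.mem_map, forall_exists_index,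
    and_imp, Function.Embedding.subtype_apply, SimpleGraph.comap_adj]
  constructor
  · rintro ⟨h1, h2⟩
    refine ⟨fun u hu v hv => h1 _ u hu rfl _ v hv rfl, fun v hv u hu huv =>
      h2 _ v hv rfl _ ?_ huv⟩
    rintro ⟨w, hw, hwu⟩
    exact hu (Subtype.ext hwu ▸ hw)
  · rintro ⟨h1, h2⟩
    refine ⟨?_, ?_⟩
    · rintro _ u hu rfl _ v hv rfl
      exact h1 u hu v hv
    · rintro _ v hv rfl u hu huv
      by_cases hS : u ∈ S
      · exact h2 v hv ⟨u, hS⟩ (fun h => hu ⟨_, h, rfl⟩) huv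
      · exact hτ u hS

open Classical in
lemma sum_powerset_map {W M : Type*} [AddCommMonoid M] (e : W ↪ V) (Λ : Finset W)
    (f : Finset V → M) :
    ∑ J ∈ (Λ.map e).powerset, f J = ∑ I ∈ Λ.powerset, f (I.map e) := by
  symm
  refine Finset.sum_nbij (fun I => I.map e) ?_ ?_ ?_ (fun _ _ => rfl)
  · intro I hI
    rw [Finset.mem_powerset] at hI ⊢
    exact Finset.map_subset_map.2 hI
  · exact fun I _ J _ h => Finset.map_injective e h
  · intro J hJ
    rw [Finset.mem_coe, Finset.mem_powerset, Finset.subset_map_iff] at hJ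
    obtain ⟨I, hI, rfl⟩ := hJ
    exact ⟨I, by simpa using hI, rfl⟩

/-- Vertices outside `S` that are frozen at spin `0` exert no constraint, as if they were deleted.
-/
lemma condProb_induce (G : SimpleGraph V) (lam : ℝ) (S : Set V) (Λ : Finset S) (τ : V → Bool)
    (hτ : ∀ v ∉ S, τ v = false) (A : Set (S → Bool)) :
    condProb (G.induce S) lam Λ (fun v => τ v) A =
      condProb G lam (Λ.map (.subtype _)) τ {σ | (fun v : S => σ v) ∈ A} := by
  classical
  have key : ∀ A : Set (S → Bool), condSum (G.induce S) lam Λ (fun v => τ v) A =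
      condSum G lam (Λ.map (.subtype _)) τ {σ | (fun v : S => σ v) ∈ A} := by
    intro A
    rw [condSum, condSum, sum_powerset_map]
    refine Finset.sum_congr rfl fun I _ => ?_
    simp only [admissible_map G S Λ I τ hτ, Set.mem_ofPred_eq, glue_map, Finset.card_map]
  rw [condProb_eq_div, condProb_eq_div, key, key]
  rfl

lemma finite_ball {G : SimpleGraph V} (hG : ∀ v, {u | G.Adj v u}.Finite) {X : Set V}
    (hX : X.Finite) (r : ℕ) : (ball G X r).Finite := by
  have key : ∀ (n : ℕ) (v : V), {u | ∃ p : G.Walk v u, p.length = n}.Finite := by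
    intro n
    induction n with
    | zero =>
      intro v
      refine (Set.finite_singleton v).subset ?_
      rintro u ⟨p, hp⟩
      exact (SimpleGraph.Walk.eq_of_length_eq_zero hp).symm
    | succ n ih =>
      intro v
      refine ((hG v).biUnion fun w _ => ih w).subset ?_
      rintro u ⟨p, hp⟩
      cases p with
      | nil => simp at hp
      | cons h q =>
        simp only [SimpleGraph.Walk.length_cons, Nat.add_right_cancel_iff] at hp
        exact Set.mem_biUnion (show _ ∈ {u | G.Adj v u} from h) ⟨q, hp⟩
  refine (hX.biUnion fun v _ => (Set.finite_Iic r).biUnion fun n _ => key n v).subset ?_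
  rintro u ⟨v, hv, huv⟩
  obtain ⟨p, hp⟩ := SimpleGraph.exists_walk_of_edist_ne_top
    (ne_top_of_le_ne_top (ENat.natCast_ne_top r) huv)
  rw [← hp] at huv
  exact Set.mem_biUnion hv (Set.mem_biUnion (show p.length ∈ Set.Iic r by exact_mod_cast huv)
    ⟨p, rfl⟩)

/-- Strong spatial mixing passes to all induced subgraphs. -/
lemma StrongSpatialMixing.spatialMixing_induce {G : SimpleGraph V}
    (hG : ∀ v, {u | G.Adj v u}.Finite) {lam : ℝ} (h : StrongSpatialMixing G lam) (S : Set V) :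
    SpatialMixing (G.induce S) lam := by
  classical
  intro X ε hε
  let X' : Finset V := X.map (.subtype _)
  -- The complement of `S` plays the part of `Y`, which may be infinite; its spins will be frozen at
  -- `0`.
  obtain ⟨R, hR, hmix⟩ := h X' Sᶜ
  obtain ⟨r, hRr, hr⟩ := ((hR.eventually (gt_mem_nhds hε)).and (eventually_ge_atTop 1)).exists
  have hfin : (ball G (X' : Set V) r \ (Sᶜ ∪ boundary G (ball G X' r))).Finite :=
    (finite_ball hG X'.finite_toSet r).subset Set.sdiff_subset
  let Λ' : Finset V := hfin.toFinset
  have hΛ' : (Λ' : Set V) = ball G X' r \ (Sᶜ ∪ boundary G (ball G X' r)) := hfin.coe_toFinset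
  have hmem : ∀ v, v ∈ Λ' ↔ v ∈ ball G X' r ∧ ¬ (v ∈ Sᶜ ∨ v ∈ boundary G (ball G X' r)) :=
    fun v => hfin.mem_toFinset
  let Λ : Finset S := Λ'.subtype (· ∈ S)
  have hΛ : Λ.map (.subtype _) = Λ' := by
    refine Finset.subtype_map_of_mem fun v hv => ?_
    by_contra hS
    exact ((hmem v).1 hv).2 (.inl hS)
  have hXS : ∀ v : S, v ∈ X → (v : V) ∈ X' := fun v hv => Finset.mem_map_of_mem _ hv
  refine ⟨Λ, fun x hx => ?_, fun s τ hτ => ?_⟩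
  · rw [Finset.mem_subtype, hmem]
    refine ⟨⟨x, hXS x hx, by simp⟩, ?_⟩
    rintro (hS | ⟨-, u, hu, hub⟩)
    · exact hS x.2
    · refine hub ⟨x, hXS x hx, ?_⟩
      -- As `1 ≤ r`, every neighbour of `X'` is in the ball, so no vertex of `X'` is on its
      -- boundary.
      rw [SimpleGraph.edist_eq_one_iff_adj.2 hu]
      exact_mod_cast hr
  · let ext : (S → Bool) → V → Bool := fun σ v => if hv : v ∈ S then σ ⟨v, hv⟩ else false
    have hext : ∀ σ, (fun v : S => ext σ v) = σ := fun σ => by funext v; simp [ext]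
    have hext0 : ∀ σ, ∀ v ∉ S, ext σ v = false := fun σ v hv => by simp [ext, hv]
    have hind : ∀ σ, IsIndependent (G.induce S) σ → IsIndependent G (ext σ) := by
      rintro σ hσ u v huv ⟨h1, h2⟩
      have hu : u ∈ S := by
        by_contra hu; simp [ext, hu] at h1
      have hv : v ∈ S := by
        by_contra hv; simp [ext, hv] at h2
      refine hσ ⟨u, hu⟩ ⟨v, hv⟩ huv ⟨?_, ?_⟩
      · simpa [ext, hu] using h1
      · simpa [ext, hv] using h2
    have hcond : ∀ σ, condProb (G.induce S) lam Λ σ (cylinder X s) =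
        condProb G lam Λ' (ext σ) {ρ | ∀ v ∈ X', ρ v = ext s v} := by
      intro σ
      have := condProb_induce G lam S Λ (ext σ) (hext0 σ) (cylinder X s)
      rw [hext, hΛ] at this
      rw [this]
      congr 1
      ext ρ
      simp only [mem_cylinder, Set.mem_ofPred_eq, Finset.mem_map, X',
        Function.Embedding.subtype_apply, forall_exists_index, and_imp, ext]
      refine ⟨?_, fun hρ v hv => by simpa using hρ v v hv rfl⟩
      rintro hρ _ v hv rfl
      simpa using hρ v hv
    rw [hcond, hcond]
    have h0 : IsIndependent (G.induce S) fun _ => false := fun u v _ hb => by simp at hb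
    exact (hmix r hr Λ' hΛ' (ext s) (ext τ) (ext fun _ => false) (hind τ hτ) (hind _ h0)
      fun v hv => (hext0 τ v hv).trans (hext0 (fun _ => false) v hv).symm).trans hRr.le

/-! ### Partition functions -/

open Classical in
lemma partitionFunction_eq_sum_ite (G : SimpleGraph V) (lam : ℝ) (Λ : Finset V) :
    partitionFunction G lam Λ =
      ∑ I ∈ Λ.powerset, if G.IsIndepSet (I : Set V) then lam ^ I.card else 0 := by
  rw [partitionFunction, Finset.sum_filter]

lemma partitionFunction_map {W : Type*} (G : SimpleGraph V) (H : SimpleGraph W) (lam : ℝ)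
    (e : W ↪ V) (he : ∀ a b, G.Adj (e a) (e b) ↔ H.Adj a b) (Λ : Finset W) :
    partitionFunction G lam (Λ.map e) = partitionFunction H lam Λ := by
  classical
  rw [partitionFunction_eq_sum_ite, partitionFunction_eq_sum_ite, sum_powerset_map]
  refine Finset.sum_congr rfl fun I _ => ?_
  have : G.IsIndepSet (I.map e : Set V) ↔ H.IsIndepSet (I : Set W) := by
    simp [isIndepSet_iff, he]
  simp only [this, Finset.card_map]

lemma condSum_empty_univ (G : SimpleGraph V) (lam : ℝ) (Λ : Finset V) :
    condSum G lam Λ (fun _ => false) Set.univ = partitionFunction G lam Λ := by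
  classical
  simp [condSum_univ, partitionFunction_eq_sum_ite, Admissible]

lemma partitionFunction_pos (G : SimpleGraph V) {lam : ℝ} (hlam : 0 < lam) (Λ : Finset V) :
    0 < partitionFunction G lam Λ := by
  rw [← condSum_empty_univ]
  exact condSum_univ_pos G hlam _ _

/-- The bridge between Gibbs probabilities and telescoping: independent sets that avoid `o` are
those of `Λ.erase o`. -/
lemma condProb_vacant (G : SimpleGraph V) [DecidableEq V] (lam : ℝ) {Λ : Finset V} {o : V}
    (ho : o ∈ Λ) :
    condProb G lam Λ (fun _ => false) (cylinder {o} fun _ => false) =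
      partitionFunction G lam (Λ.erase o) / partitionFunction G lam Λ := by
  classical
  rw [condProb_eq_div, condSum_empty_univ]
  congr 1
  rw [condSum, partitionFunction, ← Finset.sum_filter]
  refine Finset.sum_congr ?_ fun _ _ => rfl
  ext I
  simp only [Admissible, Finset.mem_filter, Finset.mem_powerset, mem_cylinder, glue,
    Finset.mem_singleton, forall_eq, ho, if_true, decide_eq_false_iff_not, implies_true,
    and_true, Finset.subset_erase]
  tauto

open Classical in
lemma partitionFunction_eq_erase_add (G : SimpleGraph V) [DecidableEq V] (lam : ℝ) {Λ : Finset V}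
    {v : V} (hv : v ∈ Λ) :
    partitionFunction G lam Λ = partitionFunction G lam (Λ.erase v) +
      ∑ I ∈ (Λ.erase v).powerset,
        if G.IsIndepSet ((insert v I : Finset V) : Set V) then lam ^ (I.card + 1) else 0 := by
  conv_lhs => rw [← Finset.insert_erase hv]
  rw [partitionFunction_eq_sum_ite, Finset.sum_powerset_insert (Finset.notMem_erase v Λ),
    partitionFunction_eq_sum_ite]
  congr 1
  refine Finset.sum_congr rfl fun I hI => ?_
  have : v ∉ I := fun h => Finset.notMem_erase v Λ (Finset.mem_powerset.1 hI h)
  rw [Finset.card_insert_of_notMem this]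
  congr

/-- Removing `v` keeps a set independent and divides its weight by `lam`, so the sets containing `v`
contribute at most `lam` times the partition function without `v`. -/
lemma partitionFunction_le_mul_erase (G : SimpleGraph V) [DecidableEq V] {lam : ℝ}
    (hlam : 0 < lam) {Λ : Finset V} {v : V} (hv : v ∈ Λ) :
    partitionFunction G lam Λ ≤ (1 + lam) * partitionFunction G lam (Λ.erase v) := by
  classical
  have h := partitionFunction_eq_erase_add G lam hv
  have h0 : ∑ I ∈ (Λ.erase v).powerset,
      (if G.IsIndepSet ((insert v I : Finset V) : Set V) then lam ^ (I.card + 1) else 0) ≤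
        lam * partitionFunction G lam (Λ.erase v) := by
    rw [partitionFunction_eq_sum_ite, Finset.mul_sum]
    refine Finset.sum_le_sum fun I _ => ?_
    split_ifs with h1 h2
    · rw [pow_succ']
    · exact absurd (Set.Pairwise.mono (by simp) h1) h2
    · positivity
    · simp
  rw [h]
  linarith

lemma partitionFunction_of_isIndepSet (G : SimpleGraph V) (lam : ℝ) {Λ : Finset V}
    (h : G.IsIndepSet (Λ : Set V)) : partitionFunction G lam Λ = (1 + lam) ^ Λ.card := by
  classical
  rw [partitionFunction_eq_sum_ite, add_comm, ← Finset.sum_pow_mul_eq_add_pow]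
  refine Finset.sum_congr rfl fun I hI => ?_
  rw [Finset.mem_powerset] at hI
  rw [if_pos (Set.Pairwise.mono (by exact_mod_cast hI) h), one_pow, mul_one]

lemma partitionFunction_empty (G : SimpleGraph V) (lam : ℝ) : partitionFunction G lam ∅ = 1 := by
  rw [partitionFunction_of_isIndepSet G lam (by simp [isIndepSet_iff])]
  simp

/-- Telescoping a set function along an order. -/
lemma sum_sub_eq_of_order {α : Type*} [DecidableEq α] (r : α → α → Prop)
    [DecidableRel r] [IsStrictTotalOrder α r] (F : Finset α → ℝ) (Λ : Finset α) :
    ∑ v ∈ Λ, (F (insert v {u ∈ Λ | r u v}) - F {u ∈ Λ | r u v}) = F Λ - F ∅ := by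
  let _ : LinearOrder α := linearOrderOfSTO r
  have hlt : ∀ a b : α, a < b ↔ r a b := fun _ _ => Iff.rfl
  -- A new maximum precedes no other element, so the earlier terms do not change.
  induction Λ using Finset.induction_on_max with
  | empty => simp
  | insert m Λ hm ih =>
    have hmΛ : m ∉ Λ := fun h => lt_irrefl m (hm m h)
    have h1 : {u ∈ insert m Λ | r u m} = Λ := by
      ext u
      simp only [Finset.mem_filter, Finset.mem_insert, ← hlt]
      constructor
      · rintro ⟨rfl | h, h'⟩
        · exact absurd h' (lt_irrefl _)
        · exact h
      · exact fun h => ⟨.inr h, hm u h⟩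
    have h2 : ∀ v ∈ Λ, {u ∈ insert m Λ | r u v} = {u ∈ Λ | r u v} := by
      intro v hv
      rw [Finset.filter_insert, if_neg]
      rw [← hlt]
      exact (hm v hv).not_gt
    rw [Finset.sum_insert hmΛ, h1,
      Finset.sum_congr rfl fun v hv => by rw [h2 v hv], ih]
    ring

/-- From `log t ≤ t - 1`. It will be used with `c = (1 + lam)⁻¹`. -/
lemma abs_log_sub_log_le {c x y : ℝ} (hc : 0 < c) (hx : c ≤ x) (hy : c ≤ y) :
    |Real.log x - Real.log y| ≤ |x - y| / c := by
  have key : ∀ x y : ℝ, c ≤ x → c ≤ y → Real.log x - Real.log y ≤ |x - y| / c := by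
    intro x y hx hy
    have hx0 := hc.trans_le hx
    have hy0 := hc.trans_le hy
    rw [← Real.log_div hx0.ne' hy0.ne']
    calc Real.log (x / y) ≤ x / y - 1 := Real.log_le_sub_one_of_pos (div_pos hx0 hy0)
      _ = (x - y) / y := by field_simp
      _ ≤ |x - y| / y := by gcongr; exact le_abs_self _
      _ ≤ |x - y| / c := by gcongr
  rw [abs_le]
  have h1 := key x y hx hy
  have h2 := key y x hy hx
  rw [abs_sub_comm] at h2
  constructor <;> linarith

/-- Under spatial mixing on an induced subgraph, the probability that a vertex `o` is vacant is
approximated by ratios of partition functions of finite subsets. -/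
lemma SpatialMixing.exists_ratio_near [Countable V] [DecidableEq V] {G : SimpleGraph V} {lam : ℝ}
    (hlam : 0 < lam) {S : Set V} (h : SpatialMixing (G.induce S) lam) {μ : Measure (S → Bool)}
    (hμ : IsGibbs (G.induce S) lam μ) (o : S) {ε : ℝ} (hε : 0 < ε) :
    ∃ W : Finset V, (o : V) ∈ W ∧ (W : Set V) ⊆ S ∧
      ∀ T : Finset V, (T : Set V) ⊆ S → W ⊆ T →
      |partitionFunction G lam (T.erase o) / partitionFunction G lam T -
        μ.real {σ | σ o = false}| ≤ ε := by
  classical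
  obtain ⟨Λ, ho, hΛ⟩ := h.exists_condProb_near hlam hμ {o} (fun _ => false) hε
  rw [Finset.singleton_subset_iff] at ho
  refine ⟨Λ.map (.subtype _), Finset.mem_map_of_mem _ ho, ?_, fun T hT hW => ?_⟩
  · intro v hv
    simp only [Finset.coe_map, Function.Embedding.subtype_apply, Set.mem_image] at hv
    obtain ⟨w, -, rfl⟩ := hv
    exact w.2
  · obtain ⟨T', rfl⟩ : ∃ T' : Finset S, T'.map (.subtype _) = T :=
      ⟨T.subtype (· ∈ S), Finset.subtype_map_of_mem fun v hv => hT hv⟩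
    have hΛT : Λ ⊆ T' := Finset.map_subset_map.1 hW
    have hcyl : cylinder {o} (fun _ => false) = {σ : S → Bool | σ o = false} := by
      ext σ; simp [mem_cylinder]
    have he : (T'.map (.subtype _)).erase (o : V) = (T'.erase o).map (.subtype _) := by
      rw [Finset.map_erase]; rfl
    have := hΛ T' hΛT
    rw [condProb_vacant _ _ (hΛT ho), hcyl] at this
    rw [he, partitionFunction_map G (G.induce S) lam _ (fun _ _ => Iff.rfl),
      partitionFunction_map G (G.induce S) lam _ (fun _ _ => Iff.rfl)]
    exact this

lemma inv_le_ratio (G : SimpleGraph V) [DecidableEq V] {lam : ℝ} (hlam : 0 < lam)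
    {Λ : Finset V} {v : V} (hv : v ∈ Λ) :
    (1 + lam)⁻¹ ≤ partitionFunction G lam (Λ.erase v) / partitionFunction G lam Λ := by
  rw [le_div_iff₀ (partitionFunction_pos G hlam Λ), inv_mul_le_iff₀ (by positivity)]
  exact partitionFunction_le_mul_erase G hlam hv

lemma ratio_le_one (G : SimpleGraph V) [DecidableEq V] {lam : ℝ} (hlam : 0 < lam)
    {Λ : Finset V} {v : V} (hv : v ∈ Λ) :
    partitionFunction G lam (Λ.erase v) / partitionFunction G lam Λ ≤ 1 := by
  rw [← condProb_vacant G lam hv]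
  exact condProb_le_one G hlam _ _ _

lemma inv_le_vacant [Countable V] {G : SimpleGraph V} {lam : ℝ}
    (hlam : 0 < lam) {S : Set V} (h : SpatialMixing (G.induce S) lam) {μ : Measure (S → Bool)}
    (hμ : IsGibbs (G.induce S) lam μ) (o : S) : (1 + lam)⁻¹ ≤ μ.real {σ | σ o = false} := by
  classical
  refine le_of_forall_pos_le_add fun ε hε => ?_
  obtain ⟨W, ho, hWS, hW⟩ := h.exists_ratio_near hlam hμ o hε
  have h1 := hW W hWS subset_rfl
  have h2 := inv_le_ratio G hlam ho
  rw [abs_le] at h1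
  linarith [h1.1, h1.2]

/-! ### The lattice and its lexicographic order -/

section Lattice

variable {d : ℕ}

lemma lattice_adj_iff {u v : Fin d → ℤ} : (lattice d).Adj u v ↔ ∑ j, |u j - v j| = 1 := Iff.rfl

lemma abs_sub_le_of_adj {u v : Fin d → ℤ} (h : (lattice d).Adj u v) (j : Fin d) :
    |u j - v j| ≤ 1 := by
  rw [← lattice_adj_iff.1 h]
  exact Finset.single_le_sum (f := fun j => |u j - v j|) (fun _ _ => abs_nonneg _)
    (Finset.mem_univ j)

lemma finite_neighbors (v : Fin d → ℤ) : {u | (lattice d).Adj v u}.Finite := by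
  refine (Set.finite_Icc (fun j => v j - 1) (fun j => v j + 1)).subset fun u hu => ?_
  have h := fun j => abs_le.1 (abs_sub_le_of_adj hu j)
  exact ⟨fun j => by have := h j; change v j - 1 ≤ u j; omega,
    fun j => by have := h j; change u j ≤ v j + 1; omega⟩

lemma odd_sum_of_adj {u v : Fin d → ℤ} (h : (lattice d).Adj u v) :
    Odd (∑ j, u j) ↔ ¬ Odd (∑ j, v j) := by
  -- An integer and its absolute value have the same parity, so adjacency makes the difference of
  -- coordinate sums odd.
  have key : ∀ s : Finset (Fin d), (Even (∑ j ∈ s, |u j - v j|) ↔ Even (∑ j ∈ s, (u j - v j))) := by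
    intro s
    induction s using Finset.induction_on with
    | empty => simp
    | insert a s ha ih => simp only [Finset.sum_insert ha, Int.even_add, ih, even_abs]
  have h1 := key Finset.univ
  rw [lattice_adj_iff.1 h, Finset.sum_sub_distrib, Int.even_sub] at h1
  simp only [← Int.not_even_iff_odd]
  have : ¬ Even (1 : ℤ) := by decide
  tauto

lemma partitionFunction_translate (lam : ℝ) (v : Fin d → ℤ) (Λ : Finset (Fin d → ℤ)) :
    partitionFunction (lattice d) lam (Λ.map (Equiv.subRight v).toEmbedding) =
      partitionFunction (lattice d) lam Λ :=
  partitionFunction_map _ _ _ _ (fun a b => by simp [lattice_adj_iff]) _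

instance isStrictTotalOrder_prec : IsStrictTotalOrder (Fin d → ℤ) Prec where
  irrefl := by
    rintro a ⟨k, hk, -⟩
    exact lt_irrefl _ hk
  trans := by
    rintro a b c ⟨k, hk, hk'⟩ ⟨l, hl, hl'⟩
    rcases lt_trichotomy k l with h | rfl | h
    · exact ⟨l, (hk' l h) ▸ hl, fun j hj => (hk' j (h.trans hj)).trans (hl' j hj)⟩
    · exact ⟨k, hk.trans hl, fun j hj => (hk' j hj).trans (hl' j hj)⟩
    · exact ⟨k, (hl' k h) ▸ hk, fun j hj => (hk' j hj).trans (hl' j (h.trans hj))⟩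
  trichotomous := by
    intro a b hab hba
    by_contra hne
    have hs : (Finset.univ.filter fun j => a j ≠ b j).Nonempty := by
      obtain ⟨j, hj⟩ := Function.ne_iff.1 hne
      exact ⟨j, by simpa using hj⟩
    obtain ⟨k, hk, hmax⟩ := Finset.exists_max_image _ id hs
    have hgt : ∀ j, k < j → a j = b j := by
      intro j hj
      by_contra hne'
      exact (hmax j (by simpa using hne')).not_gt hj
    rcases lt_or_gt_of_ne (Finset.mem_filter.1 hk).2 with h | h
    · exact hab ⟨k, h, hgt⟩
    · exact hba ⟨k, h, fun j hj => (hgt j hj).symm⟩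

lemma prec_sub_zero {u v : Fin d → ℤ} : Prec (u - v) 0 ↔ Prec u v := by
  simp [Prec, sub_eq_zero]

lemma prec_zero_sub {u v : Fin d → ℤ} : Prec 0 (u - v) ↔ Prec v u := by
  refine exists_congr fun k => and_congr (by simp) (forall₂_congr fun j _ => ?_)
  simp only [Pi.zero_apply, Pi.sub_apply]
  omega

lemma sub_mem_past {u v : Fin d → ℤ} : u - v ∈ past d ↔ Prec u v ∨ u = v := by
  simp [past, prec_sub_zero, sub_eq_zero, or_comm]

/-- Translation by an even `v` preserves parity. Odd vertices before `v` belong to its past and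
those after it to the added part, so every odd vertex is included. -/
lemma sub_mem_pastEven {u v : Fin d → ℤ} (hv : ¬ Odd (∑ j, v j)) :
    u - v ∈ pastEven d ↔ (Prec u v ∨ u = v) ∨ Odd (∑ j, u j) := by
  have h1 : Odd (∑ j, (u - v) j) ↔ Odd (∑ j, u j) := by
    simp only [Pi.sub_apply, Finset.sum_sub_distrib, Int.odd_sub]
    rw [Int.not_odd_iff_even] at hv
    tauto
  rw [pastEven, Set.mem_union, sub_mem_past, Set.mem_ofPred_eq, h1, prec_zero_sub]
  have := (isStrictTotalOrder_prec (d := d)).trichotomous u v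
  tauto

/-! ### Van Hove sequences -/

variable {Λ : ℕ → Finset (Fin d → ℤ)}

lemma adj_add_single (v : Fin d → ℤ) (i : Fin d) {c : ℤ} (hc : |c| = 1) :
    (lattice d).Adj v (v + Pi.single i c) := by
  rw [lattice_adj_iff, Finset.sum_eq_single i]
  · simp [hc]
  · intro j _ hj
    simp [hj]
  · simp

lemma IsVanHove.card_pos (h : IsVanHove Λ) (n : ℕ) : 0 < (Λ n).card :=
  Finset.card_pos.2 ⟨0, h.monotone (Nat.zero_le n) h.zero_mem⟩

lemma IsVanHove.tendsto_escape_unit (h : IsVanHove Λ) (i : Fin d) {c : ℤ} (hc : |c| = 1) :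
    Tendsto (fun n => (((Λ n).filter fun v => v + Pi.single i c ∉ Λ n).card : ℝ) / (Λ n).card)
      atTop (𝓝 0) := by
  refine squeeze_zero (fun n => by positivity) (fun n => ?_) h.boundary_small
  gcongr
  rw [← Set.ncard_coe_finset]
  refine Set.ncard_le_ncard ?_ ((Λ n).finite_toSet.subset fun v hv => hv.1)
  intro v hv
  rw [Finset.mem_coe, Finset.mem_filter] at hv
  exact ⟨hv.1, _, adj_add_single v i hc, by simpa using hv.2⟩

/-- The vertices of a van Hove sequence which leave it under a given translation are negligible. -/
lemma IsVanHove.tendsto_escape (h : IsVanHove Λ) (u : Fin d → ℤ) :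
    Tendsto (fun n => (((Λ n).filter fun v => v + u ∉ Λ n).card : ℝ) / (Λ n).card)
      atTop (𝓝 0) := by
  -- The translations with negligible escape form a submonoid: a vertex leaving under `a + b` leaves
  -- under `a`, or its translate by `a` leaves under `b`. The signed unit vectors belong to it and
  -- generate everything.
  let M : AddSubmonoid (Fin d → ℤ) :=
    { carrier := {u | Tendsto (fun n =>
        (((Λ n).filter fun v => v + u ∉ Λ n).card : ℝ) / (Λ n).card) atTop (𝓝 0)}
      zero_mem' := by
        have : ∀ n, (Λ n).filter (fun v => v + 0 ∉ Λ n) = ∅ := by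
          intro n
          ext v
          simp
        simp only [Set.mem_ofPred_eq, this]
        simp
      add_mem' := by
        intro a b ha hb
        have hab := ha.add hb
        rw [add_zero] at hab
        refine squeeze_zero (fun n => by positivity) (fun n => ?_) hab
        rw [← add_div]
        gcongr
        have hsub : (Λ n).filter (fun v => v + (a + b) ∉ Λ n) ⊆
            (Λ n).filter (fun v => v + a ∉ Λ n) ∪
              ((Λ n).filter fun v => v + b ∉ Λ n).image (fun v => v - a) := by
          intro v hv
          rw [Finset.mem_filter] at hv
          by_cases hva : v + a ∈ Λ n
          · refine Finset.mem_union_right _ (Finset.mem_image.2 ⟨v + a, ?_, by simp⟩)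
            rw [Finset.mem_filter, add_assoc]
            exact ⟨hva, hv.2⟩
          · exact Finset.mem_union_left _ (Finset.mem_filter.2 ⟨hv.1, hva⟩)
        exact_mod_cast (Finset.card_le_card hsub).trans
          ((Finset.card_union_le _ _).trans (Nat.add_le_add_left Finset.card_image_le _)) }
  change u ∈ M
  have hunit : ∀ i, Pi.single i (u i) ∈ M := by
    intro i
    have hp : Pi.single i 1 ∈ M := h.tendsto_escape_unit i (by simp)
    have hm : Pi.single i (-1) ∈ M := h.tendsto_escape_unit i (by simp)
    obtain ⟨n, hn | hn⟩ := Int.eq_nat_or_neg (u i)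
    · have := M.nsmul_mem hp n
      rw [← Pi.single_smul] at this
      rw [hn]
      simpa using this
    · have := M.nsmul_mem hm n
      rw [← Pi.single_smul] at this
      rw [hn]
      simpa using this
  have := M.sum_mem (t := Finset.univ) fun i _ => hunit i
  rwa [Finset.univ_sum_single] at this

/-- Averages along a van Hove sequence of a function which is close to `a` except near the
boundary. -/
lemma IsVanHove.tendsto_average (h : IsVanHove Λ) (E : (Fin d → ℤ) → Prop) [DecidablePred E]
    (f : ℕ → (Fin d → ℤ) → ℝ) {a C : ℝ} (hC : 0 ≤ C)
    (hbound : ∀ n, ∀ v ∈ Λ n, E v → |f n v - a| ≤ C)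
    (hnear : ∀ ε > 0, ∃ W : Finset (Fin d → ℤ), ∀ n, ∀ v ∈ Λ n, E v →
      (∀ w ∈ W, v + w ∈ Λ n) → |f n v - a| ≤ ε) :
    Tendsto (fun n => (∑ v ∈ (Λ n).filter E, (f n v - a)) / (Λ n).card) atTop (𝓝 0) := by
  rw [Metric.tendsto_nhds]
  intro ε hε
  obtain ⟨W, hW⟩ := hnear (ε / 2) (half_pos hε)
  have hlim : Tendsto (fun n => C * ∑ w ∈ W,
      (((Λ n).filter fun v => v + w ∉ Λ n).card : ℝ) / (Λ n).card) atTop (𝓝 0) := by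
    have := (tendsto_finsetSum W fun w _ => h.tendsto_escape w).const_mul C
    simpa using this
  filter_upwards [hlim.eventually (gt_mem_nhds (half_pos hε))] with n hn
  have hcard : (0 : ℝ) < (Λ n).card := by exact_mod_cast h.card_pos n
  -- A union bound: each `w ∈ W` which carries `v` out of `Λ n` is charged the full error `C`.
  have hpt : ∀ v ∈ (Λ n).filter E, |f n v - a| ≤
      ε / 2 + ∑ w ∈ W, if v + w ∉ Λ n then C else 0 := by
    intro v hv
    rw [Finset.mem_filter] at hv
    have hnn : ∀ w ∈ W, 0 ≤ (if v + w ∉ Λ n then C else 0) := by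
      intro w _
      split_ifs <;> simp [hC]
    by_cases hdeep : ∀ w ∈ W, v + w ∈ Λ n
    · exact (hW n v hv.1 hv.2 hdeep).trans (le_add_of_nonneg_right (Finset.sum_nonneg hnn))
    · push Not at hdeep
      obtain ⟨w, hw, hvw⟩ := hdeep
      have h1 := Finset.single_le_sum hnn hw
      rw [if_pos hvw] at h1
      linarith [hbound n v hv.1 hv.2]
  have hsum : |∑ v ∈ (Λ n).filter E, (f n v - a)| ≤ ε / 2 * (Λ n).card +
      C * ∑ w ∈ W, (((Λ n).filter fun v => v + w ∉ Λ n).card : ℝ) := by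
    calc |∑ v ∈ (Λ n).filter E, (f n v - a)|
        ≤ ∑ v ∈ (Λ n).filter E, |f n v - a| := Finset.abs_sum_le_sum_abs _ _
      _ ≤ ∑ v ∈ (Λ n).filter E, (ε / 2 + ∑ w ∈ W, if v + w ∉ Λ n then C else 0) :=
          Finset.sum_le_sum hpt
      _ ≤ ∑ v ∈ Λ n, (ε / 2 + ∑ w ∈ W, if v + w ∉ Λ n then C else 0) := by
          refine Finset.sum_le_sum_of_subset_of_nonneg (Finset.filter_subset _ _) fun v _ _ => ?_
          have : 0 ≤ ∑ w ∈ W, (if v + w ∉ Λ n then C else 0) :=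
            Finset.sum_nonneg fun w _ => by split_ifs <;> simp [hC]
          linarith
      _ = _ := by
          rw [Finset.sum_add_distrib, Finset.sum_const, nsmul_eq_mul, Finset.sum_comm,
            Finset.mul_sum, mul_comm]
          congr 1
          refine Finset.sum_congr rfl fun w _ => ?_
          rw [← Finset.sum_filter, Finset.sum_const, nsmul_eq_mul, mul_comm]
  rw [Real.dist_eq, sub_zero, abs_div, abs_of_pos hcard, div_lt_iff₀ hcard]
  rw [← Finset.sum_div, ← mul_div_assoc, div_lt_iff₀ hcard] at hn
  linarith

/-- A unit translation, available as `1 ≤ d`, exchanges the parities, so the two classes differ in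
size by at most the number of escaping vertices. -/
lemma IsVanHove.tendsto_card_odd (h : IsVanHove Λ) (hd : 1 ≤ d) :
    Tendsto (fun n => (((Λ n).filter fun v => Odd (∑ j, v j)).card : ℝ) / (Λ n).card)
      atTop (𝓝 (1 / 2)) := by
  let e : Fin d → ℤ := Pi.single ⟨0, hd⟩ 1
  have hparity : ∀ v, Odd (∑ j, (v + e) j) ↔ ¬ Odd (∑ j, v j) := fun v =>
    odd_sum_of_adj (adj_add_single v ⟨0, hd⟩ (c := 1) (by simp)).symm
  have hstep : ∀ (n : ℕ) (p q : (Fin d → ℤ) → Prop) [DecidablePred p] [DecidablePred q],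
      (∀ v, p v → q (v + e)) → ((Λ n).filter p).card ≤
        ((Λ n).filter q).card + ((Λ n).filter fun v => v + e ∉ Λ n).card := by
    intro n p q _ _ hpq
    have hsub : (Λ n).filter p ⊆ ((Λ n).filter q).image (fun v => v - e) ∪
        (Λ n).filter fun v => v + e ∉ Λ n := by
      intro v hv
      rw [Finset.mem_filter] at hv
      by_cases hve : v + e ∈ Λ n
      · exact Finset.mem_union_left _ (Finset.mem_image.2
          ⟨v + e, Finset.mem_filter.2 ⟨hve, hpq v hv.2⟩, by simp⟩)
      · exact Finset.mem_union_right _ (Finset.mem_filter.2 ⟨hv.1, hve⟩)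
    exact (Finset.card_le_card hsub).trans
      ((Finset.card_union_le _ _).trans (Nat.add_le_add_right Finset.card_image_le _))
  have hzero : Tendsto (fun n => (((Λ n).filter fun v => Odd (∑ j, v j)).card : ℝ) / (Λ n).card -
      1 / 2) atTop (𝓝 0) := by
    refine squeeze_zero_norm (fun n => ?_) (h.tendsto_escape e)
    have hcard : (0 : ℝ) < (Λ n).card := by exact_mod_cast h.card_pos n
    have h1 := hstep n (fun v => Odd (∑ j, v j)) (fun v => ¬ Odd (∑ j, v j))
      fun v hv hv' => (hparity v).1 hv' hv
    have h2 := hstep n (fun v => ¬ Odd (∑ j, v j)) (fun v => Odd (∑ j, v j))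
      fun v hv => (hparity v).2 hv
    have h3 := Finset.card_filter_add_card_filter_not (s := Λ n) fun v => Odd (∑ j, v j)
    rify at h1 h2 h3
    rw [Real.norm_eq_abs, div_sub' hcard.ne', abs_div, abs_of_pos hcard]
    gcongr
    rw [abs_le]
    constructor <;> linarith
  have := hzero.add_const (1 / 2)
  rw [zero_add] at this
  exact this.congr fun n => sub_add_cancel _ _

end Lattice

/-! ### The free energy -/

section FreeEnergy

variable {d : ℕ} {Λ : ℕ → Finset (Fin d → ℤ)}

/-- The common core of both formulas: `S` is what a vertex sees when it is added, and `E` selects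
the vertices that are added one by one. -/
lemma IsVanHove.tendsto_log_ratio (h : IsVanHove Λ) {lam : ℝ} (hlam : 0 < lam)
    {S : Set (Fin d → ℤ)} (hmix : SpatialMixing ((lattice d).induce S) lam)
    {μ : Measure (S → Bool)} (hμ : IsGibbs ((lattice d).induce S) lam μ) {o : S}
    (ho : (o : Fin d → ℤ) = 0) (E : (Fin d → ℤ) → Prop) [DecidablePred E]
    [DecidablePred (· ∈ S)] :
    Tendsto (fun n => (∑ v ∈ (Λ n).filter E,
      (Real.log (partitionFunction (lattice d) lam ((Λ n).filter fun u => u - v ∈ S)) -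
        Real.log (partitionFunction (lattice d) lam
          (((Λ n).filter fun u => u - v ∈ S).erase v)) -
        -Real.log (μ.real {σ | σ o = false}))) / (Λ n).card) atTop (𝓝 0) := by
  set p := μ.real {σ | σ o = false} with hp
  have := hμ.isProbabilityMeasure
  have hc : 0 < (1 + lam)⁻¹ := by positivity
  have hple : p ≤ 1 := measureReal_le_one
  have hpge : (1 + lam)⁻¹ ≤ p := inv_le_vacant hlam hmix hμ o
  have hmem : ∀ n, ∀ v ∈ Λ n, v ∈ (Λ n).filter fun u => u - v ∈ S := by
    intro n v hv
    rw [Finset.mem_filter, sub_self]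
    exact ⟨hv, ho ▸ o.2⟩
  have hlog : ∀ n, ∀ v ∈ Λ n, ∀ δ : ℝ,
      |partitionFunction (lattice d) lam (((Λ n).filter fun u => u - v ∈ S).erase v) /
        partitionFunction (lattice d) lam ((Λ n).filter fun u => u - v ∈ S) - p| ≤ δ →
      |Real.log (partitionFunction (lattice d) lam ((Λ n).filter fun u => u - v ∈ S)) -
        Real.log (partitionFunction (lattice d) lam
          (((Λ n).filter fun u => u - v ∈ S).erase v)) - -Real.log p| ≤ (1 + lam) * δ := by
    intro n v hv δ hδ
    have h1 := abs_log_sub_log_le hc (inv_le_ratio (lattice d) hlam (hmem n v hv)) hpge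
    rw [Real.log_div (partitionFunction_pos _ hlam _).ne' (partitionFunction_pos _ hlam _).ne',
      div_inv_eq_mul, mul_comm] at h1
    have h2 := h1.trans (mul_le_mul_of_nonneg_left hδ (by positivity))
    rw [← abs_neg]
    refine (congrArg _ ?_).trans_le h2
    ring
  refine h.tendsto_average E (C := (1 + lam) * 1) _ (by positivity) ?_ ?_
  · intro n v hv _
    refine hlog n v hv 1 ?_
    have h1 := inv_le_ratio (lattice d) hlam (hmem n v hv)
    have h2 := ratio_le_one (lattice d) hlam (hmem n v hv)
    rw [abs_le]
    constructor <;> linarith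
  · intro ε hε
    obtain ⟨W, -, hWS, hW⟩ := hmix.exists_ratio_near hlam hμ o
      (ε := ε / (1 + lam)) (by positivity)
    refine ⟨W, fun n v hv _ hvW => ?_⟩
    have h1 := hlog n v hv (ε / (1 + lam)) ?_
    · rwa [mul_div_cancel₀ _ (by positivity)] at h1
    -- Translation by `-v` moves `v` to the origin and the volume into `S`; it contains `W` because
    -- `v + w ∈ Λ n` for all `w ∈ W`.
    · have h2 := hW (((Λ n).filter fun u => u - v ∈ S).map (Equiv.subRight v).toEmbedding) ?_ ?_
      · have he : (((Λ n).filter fun u => u - v ∈ S).map (Equiv.subRight v).toEmbedding).erase 0 =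
            (((Λ n).filter fun u => u - v ∈ S).erase v).map (Equiv.subRight v).toEmbedding := by
          rw [Finset.map_erase]
          simp
        rw [ho, he, partitionFunction_translate, partitionFunction_translate] at h2
        exact h2
      · intro u hu
        rw [Finset.mem_coe, Finset.mem_map] at hu
        obtain ⟨w, hw, rfl⟩ := hu
        exact (Finset.mem_filter.1 hw).2
      · intro w hw
        rw [Finset.mem_map]
        refine ⟨v + w, Finset.mem_filter.2 ⟨hvW w hw, ?_⟩, by simp⟩
        rw [add_sub_cancel_left]
        exact hWS hw

lemma log_partitionFunction_eq_sum_past (lam : ℝ) (A : Finset (Fin d → ℤ))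
    [DecidablePred (· ∈ past d)] :
    Real.log (partitionFunction (lattice d) lam A) =
      ∑ v ∈ A, (Real.log (partitionFunction (lattice d) lam (A.filter fun u => u - v ∈ past d)) -
        Real.log (partitionFunction (lattice d) lam
          ((A.filter fun u => u - v ∈ past d).erase v))) := by
  classical
  have h := sum_sub_eq_of_order Prec
    (fun B => Real.log (partitionFunction (lattice d) lam B)) A
  rw [partitionFunction_empty, Real.log_one, sub_zero] at h
  rw [← h]
  refine Finset.sum_congr rfl fun v hv => ?_
  have hv' : v ∉ {u ∈ A | Prec u v} := fun hv' =>
    irrefl_of Prec v (Finset.mem_filter.1 hv').2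
  have e : (A.filter fun u => u - v ∈ past d) = insert v {u ∈ A | Prec u v} := by
    ext u
    simp only [Finset.mem_filter, Finset.mem_insert, sub_mem_past]
    constructor
    · tauto
    · rintro (rfl | h)
      · exact ⟨hv, .inr rfl⟩
      · exact ⟨h.1, .inl h.2⟩
  rw [e, Finset.erase_insert hv']

lemma log_partitionFunction_eq_sum_pastEven (lam : ℝ) (A : Finset (Fin d → ℤ))
    [DecidablePred (· ∈ pastEven d)] :
    Real.log (partitionFunction (lattice d) lam A) =
      ∑ v ∈ A.filter (fun v => ¬ Odd (∑ j, v j)),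
        (Real.log (partitionFunction (lattice d) lam (A.filter fun u => u - v ∈ pastEven d)) -
        Real.log (partitionFunction (lattice d) lam
          ((A.filter fun u => u - v ∈ pastEven d).erase v))) +
      (A.filter fun v => Odd (∑ j, v j)).card * Real.log (1 + lam) := by
  classical
  set O := A.filter fun v => Odd (∑ j, v j) with hO
  set E := A.filter fun v => ¬ Odd (∑ j, v j) with hE
  -- Telescoping over the even vertices with all odd ones present throughout; the initial value is
  -- `log Z` of `O`, not `0`.
  have h := sum_sub_eq_of_order Prec
    (fun B => Real.log (partitionFunction (lattice d) lam (B ∪ O))) E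
  have hEO : E ∪ O = A := by
    rw [Finset.union_comm]
    exact Finset.filter_union_filter_not_eq _ _
  have hOind : (lattice d).IsIndepSet (O : Set (Fin d → ℤ)) := by
    rw [isIndepSet_iff]
    intro u hu v hv huv
    rw [Finset.mem_coe, hO, Finset.mem_filter] at hu hv
    exact (odd_sum_of_adj huv).1 hu.2 hv.2
  rw [Finset.empty_union, hEO, partitionFunction_of_isIndepSet _ _ hOind, Real.log_pow] at h
  rw [← sub_eq_iff_eq_add, ← h]
  refine Finset.sum_congr rfl fun v hv => ?_
  rw [hE, Finset.mem_filter] at hv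
  have hv' : v ∉ {u ∈ E | Prec u v} ∪ O := by
    intro hv'
    rcases Finset.mem_union.1 hv' with h | h
    · exact irrefl_of Prec v (Finset.mem_filter.1 h).2
    · exact hv.2 (Finset.mem_filter.1 h).2
  have e : (A.filter fun u => u - v ∈ pastEven d) = insert v ({u ∈ E | Prec u v} ∪ O) := by
    ext u
    simp only [Finset.mem_filter, Finset.mem_insert, Finset.mem_union, sub_mem_pastEven hv.2, hE,
      hO]
    constructor
    · tauto
    · rintro (rfl | h)
      · exact ⟨hv.1, .inl (.inr rfl)⟩
      · tauto
  rw [Finset.insert_union, e, Finset.erase_insert hv']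

lemma IsVanHove.tendsto_of_past (h : IsVanHove Λ) {lam : ℝ} (hlam : 0 < lam)
    (hmix : SpatialMixing ((lattice d).induce (past d)) lam) {μ : Measure (past d → Bool)}
    (hμ : IsGibbs ((lattice d).induce (past d)) lam μ) :
    Tendsto (fun n => Real.log (partitionFunction (lattice d) lam (Λ n)) / (Λ n).card) atTop
      (𝓝 (-Real.log (μ.real {σ | σ (pastOrigin d) = false}))) := by
  classical
  have h1 := (h.tendsto_log_ratio hlam hmix hμ (o := pastOrigin d) rfl fun _ => True).add_const
    (-Real.log (μ.real {σ | σ (pastOrigin d) = false}))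
  rw [zero_add] at h1
  refine h1.congr fun n => ?_
  have hcard : ((Λ n).card : ℝ) ≠ 0 := by exact_mod_cast (h.card_pos n).ne'
  rw [Finset.filter_true, Finset.sum_sub_distrib, log_partitionFunction_eq_sum_past lam (Λ n),
    Finset.sum_const, nsmul_eq_mul]
  field_simp
  ring

lemma IsVanHove.tendsto_of_pastEven (h : IsVanHove Λ) (hd : 1 ≤ d) {lam : ℝ} (hlam : 0 < lam)
    (hmix : SpatialMixing ((lattice d).induce (pastEven d)) lam)
    {ν : Measure (pastEven d → Bool)}
    (hν : IsGibbs ((lattice d).induce (pastEven d)) lam ν) :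
    Tendsto (fun n => Real.log (partitionFunction (lattice d) lam (Λ n)) / (Λ n).card) atTop
      (𝓝 (-(1 / 2) * Real.log (ν.real {σ | σ (pastEvenOrigin d) = false}) +
        (1 / 2) * Real.log (1 + lam))) := by
  classical
  set q := Real.log (ν.real {σ | σ (pastEvenOrigin d) = false}) with hq
  have hodd := h.tendsto_card_odd hd
  -- Three contributions: the vanishing error, `-q` for each even vertex, and `log (1 + lam)` for
  -- each odd one.
  have h1 := ((h.tendsto_log_ratio hlam hmix hν (o := pastEvenOrigin d) rfl
    fun v => ¬ Odd (∑ j, v j)).add ((hodd.const_sub 1).mul_const (-q))).add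
      (hodd.mul_const (Real.log (1 + lam)))
  have hval : (0 : ℝ) + (1 - 1 / 2) * -q + 1 / 2 * Real.log (1 + lam) =
      -(1 / 2) * q + (1 / 2) * Real.log (1 + lam) := by ring
  rw [hval] at h1
  refine h1.congr fun n => ?_
  have hcard : ((Λ n).card : ℝ) ≠ 0 := by exact_mod_cast (h.card_pos n).ne'
  have h2 := Finset.card_filter_add_card_filter_not (s := Λ n) fun v => Odd (∑ j, v j)
  have h3 : (((Λ n).filter fun v => ¬ Odd (∑ j, v j)).card : ℝ) =
      (Λ n).card - ((Λ n).filter fun v => Odd (∑ j, v j)).card := by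
    rw [← h2]; push_cast; ring
  rw [log_partitionFunction_eq_sum_pastEven lam (Λ n), Finset.sum_sub_distrib,
    Finset.sum_const, nsmul_eq_mul, h3]
  rw [← hq]
  field_simp
  ring

/-! ### Boxes -/

/-- The box `[-n, n]^d`. -/
def box (d : ℕ) (n : ℕ) : Finset (Fin d → ℤ) :=
  Finset.Icc (fun _ => -(n : ℤ)) (fun _ => (n : ℤ))

lemma mem_box {n : ℕ} {v : Fin d → ℤ} : v ∈ box d n ↔ ∀ j, |v j| ≤ n := by
  simp only [box, Finset.mem_Icc, Pi.le_def, abs_le, forall_and]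

lemma box_mono : Monotone (box d) := fun m n hmn v hv =>
  mem_box.2 fun j => (mem_box.1 hv j).trans (by exact_mod_cast hmn)

lemma card_box (n : ℕ) : (box d n).card = (2 * n + 1) ^ d := by
  rw [box, Pi.card_Icc]
  simp only [Int.card_Icc, Finset.prod_const, Finset.card_univ, Fintype.card_fin]
  congr 1
  omega

lemma abs_sub_le_length {u v : Fin d → ℤ} (p : (lattice d).Walk u v) (j : Fin d) :
    |u j - v j| ≤ p.length := by
  induction p with
  | nil => simp
  | @cons a b c hab q ih =>
    rw [SimpleGraph.Walk.length_cons]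
    push_cast
    have := abs_sub_le (a j) (b j) (c j)
    have := abs_sub_le_of_adj hab j
    omega

/-- Equality of the two formulas needs at least one van Hove sequence along which to compare the
limits. -/
lemma isVanHove_box (d : ℕ) : IsVanHove (box d) where
  zero_mem := mem_box.2 fun j => by simp
  monotone := box_mono
  exhausts r := by
    filter_upwards [eventually_ge_atTop r] with n hn
    rintro u ⟨v, rfl, huv⟩
    obtain ⟨p, hp⟩ := SimpleGraph.exists_walk_of_edist_ne_top
      (ne_top_of_le_ne_top (ENat.natCast_ne_top r) huv)
    rw [← hp] at huv
    have hpr : p.length ≤ r := by exact_mod_cast huv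
    refine mem_box.2 fun j => ?_
    have := abs_sub_le_length p j
    rw [Pi.zero_apply, zero_sub, abs_neg] at this
    omega
  boundary_small := by
    -- For `n ≥ 1` the boundary lies in the shell between consecutive boxes, and `((2n - 1) / (2n +
    -- 1)) ^ d = (1 - 2 / (2n + 1)) ^ d`.
    have hlim : Tendsto (fun n : ℕ => 1 - (1 - 2 / (2 * (n : ℝ) + 1)) ^ d) atTop (𝓝 0) := by
      have h1 : Tendsto (fun n : ℕ => 2 * (n : ℝ) + 1) atTop atTop :=
        tendsto_atTop_add_const_right _ _
          (tendsto_natCast_atTop_atTop.const_mul_atTop (by norm_num))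
      have h2 := (((h1.const_div_atTop 2).const_sub 1).pow d).const_sub 1
      simpa using h2
    refine squeeze_zero' (Eventually.of_forall fun n => by positivity) ?_ hlim
    filter_upwards [eventually_ge_atTop 1] with n hn
    obtain ⟨m, rfl⟩ := Nat.exists_eq_add_of_le' hn
    have hsub : boundary (lattice d) (box d (m + 1) : Set (Fin d → ℤ)) ⊆
        ((box d (m + 1) \ box d m : Finset _) : Set (Fin d → ℤ)) := by
      rintro v ⟨hv, u, hvu, hu⟩
      rw [Finset.coe_sdiff]
      refine ⟨hv, fun hvm => hu (mem_box.2 fun j => ?_)⟩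
      have h1 := mem_box.1 hvm j
      have h2 := abs_sub_le_of_adj hvu j
      rw [abs_le] at h1 h2 ⊢
      push_cast
      omega
    have hle := Set.ncard_le_ncard hsub (Finset.finite_toSet _)
    rw [Set.ncard_coe_finset, Finset.card_sdiff_of_subset (box_mono (Nat.le_succ m))] at hle
    have hcm : (box d m).card ≤ (box d (m + 1)).card :=
      Finset.card_le_card (box_mono (Nat.le_succ m))
    have hle' : ((boundary (lattice d) (box d (m + 1) : Set (Fin d → ℤ))).ncard : ℝ) ≤
        (box d (m + 1)).card - (box d m).card := by
      rw [← Nat.cast_sub hcm]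
      exact_mod_cast hle
    rw [card_box, card_box] at hle'
    rw [card_box, div_le_iff₀ (by positivity)]
    refine hle'.trans (le_of_eq ?_)
    push_cast
    rw [sub_mul, ← mul_pow, one_mul]
    congr 2
    field_simp
    ring

end FreeEnergy

end HardCore

end

theorem corollary2 (d : ℕ) (hd : 1 ≤ d) (lam : ℝ) (hlam : 0 < lam)
    (hSSM : HardCore.StrongSpatialMixing (HardCore.lattice d) lam) :
    ∃ (μ : Measure (HardCore.past d → Bool)) (ν : Measure (HardCore.pastEven d → Bool)) (P : ℝ),
      HardCore.IsUniqueGibbs ((HardCore.lattice d).induce (HardCore.past d)) lam μ ∧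
      HardCore.IsUniqueGibbs ((HardCore.lattice d).induce (HardCore.pastEven d)) lam ν ∧
      HardCore.IsFreeEnergy d lam P ∧
      P = -Real.log (μ.real {σ | σ (HardCore.pastOrigin d) = false}) ∧
      P = -(1 / 2) * Real.log (ν.real {σ | σ (HardCore.pastEvenOrigin d) = false}) +
        (1 / 2) * Real.log (1 + lam) := by
  have hmix := hSSM.spatialMixing_induce HardCore.finite_neighbors
  have hfin : ∀ (S : Set (Fin d → ℤ)) (v : S),
      {u | ((HardCore.lattice d).induce S).Adj v u}.Finite := fun S v =>
    (HardCore.finite_neighbors (v : Fin d → ℤ)).preimage Subtype.val_injective.injOn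
  obtain ⟨μ, hμ⟩ := HardCore.exists_isGibbs (hfin (HardCore.past d)) hlam
  obtain ⟨ν, hν⟩ := HardCore.exists_isGibbs (hfin (HardCore.pastEven d)) hlam
  refine ⟨μ, ν, _, (hmix _).isUniqueGibbs hlam hμ, (hmix _).isUniqueGibbs hlam hν,
    fun Λ hΛ => hΛ.tendsto_of_past hlam (hmix _) hμ, rfl, ?_⟩
  -- `P` was chosen as the first expression; the second is the limit of the same sequence over
  -- boxes.
  exact tendsto_nhds_unique ((HardCore.isVanHove_box d).tendsto_of_past hlam (hmix _) hμ)
    ((HardCore.isVanHove_box d).tendsto_of_pastEven hd hlam (hmix _) hν)
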